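/- Let $\mathbb{K}$ be a field of characteristic zero. A \emph{multiquiver} is a quadruple $\Gamma=(V,E,s,t)$ where $V,E$ are sets and $s,t:E\to (V\times\mathbb{Z}_{>0})\cup\{\emptyset\}$ are functions such that (no loops) if $s(e)=(a,m)$ and $t(e)=(b,n)$ then $a\neq b$, and (local finiteness) for each $v\in V$ only finitely many edges $e$ satisfy $s(e)\in\{v\}\times\mathbb{Z}_{>0}$ or $t(e)\in\{v\}\times\mathbb{Z}_{>0}$; such edges are called incident to $v$. Its incidence matrix is the homomorphism $\gamma:\mathbb{Z}V\to\mathbb{Z}E$ of free abelian groups, \[\gamma(v)=\sum_{t(e)=(v,n)} n\,e-\sum_{s(e)=(v,n)} n\,e=\sum_{e\in E}\gamma_{ev}\,e .\] Let $R_E=\mathbb{K}[u_e\mid e\in E]$, let $\sigma_v$ ($v\in V$) be the automorphism of $R_E$ with $\sigma_v(u_e)=u_e-\gamma_{ev}$, and let $t_v=\prod_{e} u_{ev}$, the product over the edges incident to $v$, where $u_{ev}=u_e(u_e+1)\cdots(u_e+n-1)$ if $t(e)=(v,n)$ and $u_{ev}=(u_e-1)(u_e-2)\cdots(u_e-n)$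 if $s(e)=(v,n)$. Let $\mathcal{C}(\Gamma)$ be the $R_E$-ring generated by $X_v,Y_v$ ($v\in V$) with relations \[X_vr=\sigma_v(r)X_v,\quad Y_vr=\sigma_v^{-1}(r)Y_v,\quad Y_vX_v=t_v,\quad X_vY_v=\sigma_v(t_v),\quad X_vY_w=Y_wX_v\] for all $r\in R_E$ and $v,w\in V$, $v\ne w$ in the last relation. It is $\mathbb{Z}V$-graded by $\deg X_v=v$, $\deg Y_v=-v$, $\deg r=0$. The twisted generalized Weyl algebra $\mathcal{A}(\Gamma)$ is the quotient of $\mathcal{C}(\Gamma)$ by the sum of all graded two-sided ideals $J$ with $J\cap\mathcal{C}(\Gamma)_0=0$; it inherits the $\mathbb{Z}V$-grading $\mathcal{A}(\Gamma)=\bigoplus_{g\in\mathbb{Z}V}\mathcal{A}(\Gamma)_g$. Let $A_E(\mathbb{K})$ be the Weyl algebra, the $\mathbb{K}$-algebra generated by $x_e,y_e$ ($e\in E$) with relations $[x_e,x_f]=[y_e,y_f]=0$, $[y_e,x_f]=\delta_{ef}$, and $\mathbb{Z}E$-graded by $\deg x_e=e$, $\deg y_e=-e$. For $k=\sum_e k_e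 e\in\mathbb{Z}E$ put $z^k=\prod_{e\in E} z_e^{(k_e)}$ where $z_e^{(p)}=x_e^p$ if $p\ge 0$ and $z_e^{(p)}=y_e^{-p}$ if $p<0$. Let $\varphi_\Gamma:\mathcal{A}(\Gamma)\to A_E(\mathbb{K})$ be the (well-defined) $\mathbb{K}$-algebra homomorphism with \[\varphi_\Gamma(X_v)=z^{\gamma(v)},\quad \varphi_\Gamma(Y_v)=z^{-\gamma(v)}\quad(v\in V),\qquad \varphi_\Gamma(u_e)=y_ex_e\quad(e\in E).\] Then the following two statements are equivalent: (i) $\varphi_\Gamma$ is locally surjective, that is, $\varphi_\Gamma(\mathcal{A}(\Gamma)_g)=A_E(\mathbb{K})_{\gamma(g)}$ for all $g\in\mathbb{Z}V$; (ii) the underlying undirected graph of $\Gamma$ is acyclic, that is, there are no $n\ge 1$, pairwise distinct vertices $v_1,\dots,v_n$ and pairwise distinct edges $e_1,\dots,e_n$ such that for each $i$ the edge $e_i$ has one end at $v_i$ and the other at $v_{i+1}$, in either direction and with any multiplicities, where $v_{n+1}=v_1$. (In particular two edges between the same two vertices form a cycle.) -/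

import Mathlib

noncomputable section

namespace MultiquiverTGW

/-! ### Components of an algebra given by homogeneous generators -/

/-- The `K`-span of all words of total degree `d` in a family of generators `gen` with prescribed
degrees `deg`. -/
def gradedPart (K : Type*) {A G ι : Type*} [CommSemiring K] [Semiring A] [Algebra K A]
    [AddMonoid ι] (gen : G → A) (deg : G → ι) (d : ι) : Submodule K A :=
  Submodule.span K {a | ∃ l : List G, (l.map deg).sum = d ∧ (l.map gen).prod = a}

/-! ### Twisted generalized Weyl algebras -/

/-- A twisted generalized Weyl datum `(R, σ, t)` over `K` with index set `I`. -/
structure TGWDatum (K R I : Type*) [CommRing K] [Ring R] [Algebra K R] where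
  σ : I → (R ≃ₐ[K] R)
  σ_comm : ∀ i j, Commute (σ i) (σ j)
  t : I → R
  t_central : ∀ i, t i ∈ Subalgebra.center K R
  t_ne_zero : ∀ i, t i ≠ 0

/-- Generators of the twisted generalized Weyl construction. -/
inductive TGWGen (R I : Type*)
  | coeff (r : R)
  | X (i : I)
  | Y (i : I)

namespace TGWDatum

variable {K R I : Type*} [CommRing K] [Ring R] [Algebra K R]

/-- The defining relations. The first three say that `R` maps to the quotient by a homomorphism of
`K`-algebras, the others are the relations of the twisted generalized Weyl construction. -/
inductive Rel (D : TGWDatum K R I) (μ : I → I → K) :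
    FreeAlgebra K (TGWGen R I) → FreeAlgebra K (TGWGen R I) → Prop
  | coeff_add (r s : R) : Rel D μ (.ι K (.coeff (r + s))) (.ι K (.coeff r) + .ι K (.coeff s))
  | coeff_mul (r s : R) : Rel D μ (.ι K (.coeff (r * s))) (.ι K (.coeff r) * .ι K (.coeff s))
  | coeff_algebraMap (k : K) : Rel D μ (.ι K (.coeff (algebraMap K R k))) (algebraMap K _ k)
  | X_coeff (i : I) (r : R) :
      Rel D μ (.ι K (.X i) * .ι K (.coeff r)) (.ι K (.coeff (D.σ i r)) * .ι K (.X i))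
  | Y_coeff (i : I) (r : R) :
      Rel D μ (.ι K (.Y i) * .ι K (.coeff r)) (.ι K (.coeff ((D.σ i).symm r)) * .ι K (.Y i))
  | Y_X (i : I) : Rel D μ (.ι K (.Y i) * .ι K (.X i)) (.ι K (.coeff (D.t i)))
  | X_Y (i : I) : Rel D μ (.ι K (.X i) * .ι K (.Y i)) (.ι K (.coeff (D.σ i (D.t i))))
  | X_Y_ne (i j : I) (h : i ≠ j) :
      Rel D μ (.ι K (.X i) * .ι K (.Y j)) (μ i j • (.ι K (.Y j) * .ι K (.X i)))

/-- The twisted generalized Weyl construction `C_μ(R, σ, t)`: the `R`-ring generated by `X i`,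
`Y i` subject to the relations. -/
abbrev Construction (D : TGWDatum K R I) (μ : I → I → K) : Type _ := RingQuot (D.Rel μ)

/-- The generators as elements of the construction. -/
def gen (D : TGWDatum K R I) (μ : I → I → K) (a : TGWGen R I) : D.Construction μ :=
  RingQuot.mkAlgHom K (D.Rel μ) (.ι K a)

/-- Degrees of the generators: `deg (X i) = i`, `deg (Y i) = -i` and `deg r = 0`. -/
def genDeg : TGWGen R I → (I →₀ ℤ)
  | .coeff _ => 0
  | .X i => Finsupp.single i 1
  | .Y i => -Finsupp.single i 1

/-- The homogeneous component of degree `g` of the construction. -/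
def constructionPart (D : TGWDatum K R I) (μ : I → I → K) (g : I →₀ ℤ) :
    Submodule K (D.Construction μ) :=
  gradedPart K (D.gen μ) genDeg g

/-- A two-sided ideal is graded if each of its elements is a sum of homogeneous elements
of the ideal. -/
def IsGradedIdeal (D : TGWDatum K R I) (μ : I → I → K) (J : TwoSidedIdeal (D.Construction μ)) :
    Prop :=
  ∀ a ∈ J, a ∈ Submodule.span K {b | b ∈ J ∧ ∃ g, b ∈ D.constructionPart μ g}

/-- The sum of all graded ideals which have zero intersection with the degree zero component. -/
def radical (D : TGWDatum K R I) (μ : I → I → K) : TwoSidedIdeal (D.Construction μ) :=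
  sSup {J | D.IsGradedIdeal μ J ∧ ∀ a ∈ J, a ∈ D.constructionPart μ 0 → a = 0}

/-- The twisted generalized Weyl algebra `A_μ(R, σ, t)`. -/
abbrev Alg (D : TGWDatum K R I) (μ : I → I → K) : Type _ := (D.radical μ).ringCon.Quotient

/-- The quotient map from the construction to the twisted generalized Weyl algebra. -/
def toAlg (D : TGWDatum K R I) (μ : I → I → K) : D.Construction μ →ₐ[K] D.Alg μ :=
  (D.radical μ).ringCon.mkₐ K

/-- The homogeneous component of degree `g` of the twisted generalized Weyl algebra. -/
def algPart (D : TGWDatum K R I) (μ : I → I → K) (g : I →₀ ℤ) : Submodule K (D.Alg μ) :=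
  (D.constructionPart μ g).map (D.toAlg μ).toLinearMap

end TGWDatum

/-! ### The Weyl algebra -/

open scoped IsMulCommutative in
/-- Evaluation of polynomials at a family of commuting elements of a (noncommutative) algebra:
evaluation in the commutative subalgebra generated by them. -/
def aevalOfCommute (K : Type*) {E A : Type*} [CommSemiring K] [Semiring A] [Algebra K A]
    (f : E → A) (hf : ∀ i j, Commute (f i) (f j)) : MvPolynomial E K →ₐ[K] A :=
  haveI : IsMulCommutative (Algebra.adjoin K (Set.range f)) :=
    Algebra.isMulCommutative_adjoin K (by rintro _ ⟨i, rfl⟩ _ ⟨j, rfl⟩; exact hf i j)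
  (Algebra.adjoin K (Set.range f)).val.comp
    (MvPolynomial.aeval fun e => (⟨f e, Algebra.subset_adjoin ⟨e, rfl⟩⟩ :
      Algebra.adjoin K (Set.range f)))

open scoped IsMulCommutative in
theorem aevalOfCommute_X (K : Type*) {E A : Type*} [CommSemiring K] [Semiring A] [Algebra K A]
    (f : E → A) (hf : ∀ i j, Commute (f i) (f j)) (e : E) :
    aevalOfCommute K f hf (MvPolynomial.X e) = f e := by
  simp [aevalOfCommute]

/-- Generators of the Weyl algebra. -/
inductive WeylGen (E : Type*)
  | x (e : E)
  | y (e : E)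

/-- The defining relations `[x_i, x_j] = [y_i, y_j] = 0` and `[y_i, x_j] = δ_{ij}`. -/
inductive WeylRel (K E : Type*) [CommRing K] :
    FreeAlgebra K (WeylGen E) → FreeAlgebra K (WeylGen E) → Prop
  | x_x (i j : E) : WeylRel K E (.ι K (.x i) * .ι K (.x j)) (.ι K (.x j) * .ι K (.x i))
  | y_y (i j : E) : WeylRel K E (.ι K (.y i) * .ι K (.y j)) (.ι K (.y j) * .ι K (.y i))
  | y_x_self (i : E) : WeylRel K E (.ι K (.y i) * .ι K (.x i) - .ι K (.x i) * .ι K (.y i)) 1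
  | y_x_ne (i j : E) (h : i ≠ j) :
      WeylRel K E (.ι K (.y i) * .ι K (.x j) - .ι K (.x j) * .ι K (.y i)) 0

/-- The Weyl algebra over `K` with index set `E`. -/
abbrev Weyl (K E : Type*) [CommRing K] : Type _ := RingQuot (WeylRel K E)

namespace Weyl

section Basic

variable (K : Type*) {E : Type*} [CommRing K]

/-- The generators as elements of the Weyl algebra. -/
def gen (a : WeylGen E) : Weyl K E := RingQuot.mkAlgHom K (WeylRel K E) (.ι K a)

/-- The generator `x_e`. -/
def x (e : E) : Weyl K E := gen K (.x e)

/-- The generator `y_e`. -/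
def y (e : E) : Weyl K E := gen K (.y e)

/-- Degrees of the generators: `deg x_e = e` and `deg y_e = -e`. -/
def genDeg : WeylGen E → (E →₀ ℤ)
  | .x e => Finsupp.single e 1
  | .y e => -Finsupp.single e 1

/-- The homogeneous component of degree `k` of the Weyl algebra. -/
def part (k : E →₀ ℤ) : Submodule K (Weyl K E) := gradedPart K (gen K) genDeg k

theorem x_comm (i j : E) : Commute (x K i) (x K j) := by
  have := RingQuot.mkAlgHom_rel K (WeylRel.x_x (K := K) i j)
  rw [map_mul, map_mul] at this
  exact this

theorem y_comm (i j : E) : Commute (y K i) (y K j) := by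
  have := RingQuot.mkAlgHom_rel K (WeylRel.y_y (K := K) i j)
  rw [map_mul, map_mul] at this
  exact this

theorem y_mul_x (i : E) : y K i * x K i = x K i * y K i + 1 := by
  have := RingQuot.mkAlgHom_rel K (WeylRel.y_x_self (K := K) i)
  rw [map_sub, map_mul, map_mul, map_one, sub_eq_iff_eq_add'] at this
  exact this

theorem y_x_comm {i j : E} (h : i ≠ j) : Commute (y K i) (x K j) := by
  have := RingQuot.mkAlgHom_rel K (WeylRel.y_x_ne (K := K) i j h)
  rw [map_sub, map_mul, map_mul, map_zero, sub_eq_zero] at this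
  exact this

/-- The element `z_e^{(p)}`, equal to `x_e ^ p` if `p ≥ 0` and to `y_e ^ (-p)` if `p < 0`. -/
def zgen (e : E) : ℤ → Weyl K E
  | .ofNat n => x K e ^ n
  | .negSucc n => y K e ^ (n + 1)

theorem zgen_commute {i j : E} (h : i ≠ j) (p q : ℤ) : Commute (zgen K i p) (zgen K j q) := by
  cases p <;> cases q <;> simp only [zgen]
  · exact (x_comm K i j).pow_pow _ _
  · exact (y_x_comm K h.symm).symm.pow_pow _ _
  · exact (y_x_comm K h).pow_pow _ _
  · exact (y_comm K i j).pow_pow _ _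

theorem zgen_pairwise (s : Finset E) (k : E → ℤ) :
    (s : Set E).Pairwise (Function.onFun Commute fun e => zgen K e (k e)) :=
  fun _ _ _ _ h => zgen_commute K h _ _

/-- The element `z^k = ∏ z_e^{(k_e)}`; the factors commute with each other. -/
def z (k : E →₀ ℤ) : Weyl K E :=
  k.support.noncommProd (fun e => zgen K e (k e)) (zgen_pairwise K _ _)

theorem z_zero : z K (0 : E →₀ ℤ) = 1 := by
  rw [z]
  exact Finset.noncommProd_empty _ _

/-- The element `u_e = y_e x_e`. -/
def u (e : E) : Weyl K E := y K e * x K e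

theorem u_zgen_commute {i j : E} (h : i ≠ j) (p : ℤ) : Commute (u K i) (zgen K j p) := by
  have h1 := zgen_commute K h (-1) p
  have h2 := zgen_commute K h 1 p
  rw [show zgen K i (-1) = y K i from pow_one _] at h1
  rw [show zgen K i 1 = x K i from pow_one _] at h2
  exact h1.mul_left h2

theorem u_comm (i j : E) : Commute (u K i) (u K j) := by
  by_cases h : i = j
  · subst h; exact Commute.refl _
  have h1 := u_zgen_commute K h (-1)
  have h2 := u_zgen_commute K h 1
  rw [show zgen K j (-1) = y K j from pow_one _] at h1
  rw [show zgen K j 1 = x K j from pow_one _] at h2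
  exact h1.mul_right h2

/-- The structure map `K[u_e | e ∈ E] → A_E(K)`, `u_e ↦ y_e x_e`. -/
def coeff : MvPolynomial E K →ₐ[K] Weyl K E := aevalOfCommute K (u K) (u_comm K)

@[simp]
theorem coeff_X (e : E) : coeff K (MvPolynomial.X e) = u K e := by
  exact aevalOfCommute_X K _ _ e

/-- The automorphism of the polynomial ring given by `u_e ↦ u_e - c_e`. -/
def shift (c : E → ℤ) : MvPolynomial E K →ₐ[K] MvPolynomial E K :=
  MvPolynomial.aeval fun e => MvPolynomial.X e - (c e : MvPolynomial E K)

@[simp]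
theorem shift_X (c : E → ℤ) (e : E) :
    shift K c (MvPolynomial.X e) = MvPolynomial.X e - (c e : MvPolynomial E K) := by
  simp [shift]

theorem shift_comp (c d : E → ℤ) : (shift K c).comp (shift K d) = shift K (c + d) := by
  apply MvPolynomial.algHom_ext
  intro e
  simp only [AlgHom.comp_apply, shift_X, map_sub, map_intCast, Pi.add_apply, Int.cast_add]
  ring

theorem shift_zero : shift K (0 : E → ℤ) = AlgHom.id K _ := by
  apply MvPolynomial.algHom_ext
  intro e
  simp

/-- `shift` as an automorphism. -/
def shiftEquiv (c : E → ℤ) : MvPolynomial E K ≃ₐ[K] MvPolynomial E K :=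
  AlgEquiv.ofAlgHom (shift K c) (shift K (-c)) (by simp [shift_comp, shift_zero])
    (by simp [shift_comp, shift_zero])

/-- The polynomial `f` with `z_e^{(-p)} z_e^{(p)} = f(u_e)`: it is `u_e (u_e + 1) ⋯ (u_e + p - 1)`
if `p ≥ 0` and `(u_e - 1) ⋯ (u_e - |p|)` if `p < 0`. -/
def factor (e : E) : ℤ → MvPolynomial E K
  | .ofNat n => ∏ i ∈ Finset.range n, (MvPolynomial.X e + (i : MvPolynomial E K))
  | .negSucc n => ∏ i ∈ Finset.range (n + 1), (MvPolynomial.X e - ((i + 1 : ℕ) : MvPolynomial E K))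

theorem x_mul_y (e : E) : x K e * y K e = u K e - 1 := by
  rw [u, y_mul_x]; simp

theorem x_pow_u (e : E) (n : ℕ) : x K e ^ n * u K e = (u K e - n) * x K e ^ n := by
  induction n with
  | zero => simp
  | succ n ih =>
    have h : x K e * u K e = (u K e - 1) * x K e := by
      rw [← x_mul_y, u, mul_assoc]
    rw [pow_succ, mul_assoc, h, ← mul_assoc, mul_sub, ih, Nat.cast_succ, ← sub_sub, sub_mul _ 1,
      one_mul, ← mul_assoc, sub_mul (_ * _), mul_one, mul_assoc (u K e - (n : Weyl K E))]

theorem y_pow_u (e : E) (n : ℕ) : y K e ^ n * u K e = (u K e + n) * y K e ^ n := by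
  induction n with
  | zero => simp
  | succ n ih =>
    have h : y K e * u K e = (u K e + 1) * y K e := by
      have : u K e * y K e = y K e * (u K e - 1) := by rw [← x_mul_y, u, mul_assoc]
      rw [add_mul, this, mul_sub, mul_one, one_mul, sub_add_cancel]
    rw [pow_succ, mul_assoc, h, ← mul_assoc, mul_add, ih, Nat.cast_succ, ← add_assoc, add_mul _ 1,
      one_mul, ← mul_assoc, add_mul (_ * _), mul_one, mul_assoc (u K e + (n : Weyl K E))]

theorem zgen_mul_u (e : E) (p : ℤ) : zgen K e p * u K e = (u K e - p) * zgen K e p := by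
  cases p with
  | ofNat n => simpa [zgen] using x_pow_u K e n
  | negSucc n =>
    have := y_pow_u K e (n + 1)
    simp only [zgen, this, Int.cast_negSucc, sub_neg_eq_add]

theorem y_pow_x_pow (e : E) (n : ℕ) : y K e ^ n * x K e ^ n =
    coeff K (∏ i ∈ Finset.range n, (MvPolynomial.X e + (i : MvPolynomial E K))) := by
  induction n with
  | zero => simp
  | succ n ih =>
    rw [Finset.prod_range_succ_comm, map_mul, ← ih, map_add, map_natCast, coeff_X, ← mul_assoc,
      ← y_pow_u, pow_succ, pow_succ', u]
    simp only [mul_assoc]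

theorem x_pow_y_pow (e : E) (n : ℕ) : x K e ^ n * y K e ^ n =
    coeff K (∏ i ∈ Finset.range n, (MvPolynomial.X e - ((i + 1 : ℕ) : MvPolynomial E K))) := by
  induction n with
  | zero => simp
  | succ n ih =>
    have h : (u K e - ((n + 1 : ℕ) : Weyl K E)) * x K e ^ n = x K e ^ n * (u K e - 1) := by
      rw [mul_sub, x_pow_u, Nat.cast_succ, ← sub_sub, sub_mul _ 1, one_mul, mul_one]
    rw [Finset.prod_range_succ_comm, map_mul, ← ih, map_sub, map_natCast, coeff_X, ← mul_assoc,
      h, ← x_mul_y, pow_succ, pow_succ']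
    simp only [mul_assoc]

theorem zgen_neg_mul_zgen (e : E) (p : ℤ) :
    zgen K e (-p) * zgen K e p = coeff K (factor K e p) := by
  cases p with
  | ofNat n =>
    have : zgen K e (-(Int.ofNat n)) = y K e ^ n := by
      cases n with
      | zero => exact (pow_zero _).trans (pow_zero _).symm
      | succ n => rfl
    rw [this]
    exact y_pow_x_pow K e n
  | negSucc n => exact x_pow_y_pow K e (n + 1)

theorem shift_factor (c : E → ℤ) (e : E) :
    shift K c (factor K e (c e)) = factor K e (-(c e)) := by
  generalize hp : c e = p
  cases p with
  | ofNat n =>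
    have : factor K e (-(Int.ofNat n)) =
        ∏ i ∈ Finset.range n, (MvPolynomial.X e - ((i + 1 : ℕ) : MvPolynomial E K)) := by
      cases n with
      | zero => rfl
      | succ n => rfl
    rw [this, ← Finset.prod_range_reflect]
    simp only [factor, map_prod, map_add, map_natCast, shift_X, hp]
    refine Finset.prod_congr rfl fun i hi => ?_
    have hi := Finset.mem_range.1 hi
    rw [show n - 1 - i + 1 = n - i by omega, Nat.cast_sub hi.le]
    simp only [Int.ofNat_eq_natCast, Int.cast_natCast]
    ring
  | negSucc n =>
    change _ = ∏ i ∈ Finset.range (n + 1), (MvPolynomial.X e + (i : MvPolynomial E K))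
    rw [← Finset.prod_range_reflect]
    simp only [factor, map_prod, map_sub, map_natCast, shift_X, hp]
    refine Finset.prod_congr rfl fun i hi => ?_
    have hi := Finset.mem_range.1 hi
    rw [show n + 1 - 1 - i = n - i by omega, Nat.cast_sub (by omega)]
    simp only [Int.cast_negSucc]
    push_cast
    ring

open Classical in
theorem noncommProd_mul_u (s : Finset E) (k : E → ℤ) (h) (e : E) :
    s.noncommProd (fun e => zgen K e (k e)) h * u K e =
      (u K e - ((if e ∈ s then k e else 0 : ℤ) : Weyl K E)) *
        s.noncommProd (fun e => zgen K e (k e)) h := by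
  induction s using Finset.induction_on with
  | empty => simp
  | insert a s ha ih =>
    rw [Finset.noncommProd_insert_of_notMem _ _ _ _ ha, mul_assoc, ih]
    by_cases hae : e = a
    · subst hae
      simp only [ha, if_false, Int.cast_zero, sub_zero, Finset.mem_insert_self, if_true]
      rw [← mul_assoc, zgen_mul_u, mul_assoc]
    · have hc : Commute (zgen K a (k a)) (u K e) := (u_zgen_commute K hae _).symm
      have hc2 : Commute (zgen K a (k a)) (u K e - ((if e ∈ s then k e else 0 : ℤ) : Weyl K E)) :=
        hc.sub_right (Int.cast_commute _ _).symm
      rw [← mul_assoc, hc2.eq, mul_assoc]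
      simp [hae]

theorem z_mul_coeff (k : E →₀ ℤ) (r : MvPolynomial E K) :
    z K k * coeff K r = coeff K (shift K k r) * z K k := by
  induction r using MvPolynomial.induction_on with
  | C a =>
    rw [← MvPolynomial.algebraMap_eq, AlgHom.commutes, AlgHom.commutes, AlgHom.commutes]
    exact (Algebra.commutes _ _).symm
  | add p q hp hq => simp only [map_add, mul_add, add_mul, hp, hq]
  | mul_X p e hp =>
    rw [map_mul, map_mul, ← mul_assoc, hp, mul_assoc, coeff_X, map_mul, mul_assoc]
    congr 1
    rw [shift_X, map_sub, coeff_X, map_intCast, z, noncommProd_mul_u]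
    congr 3
    simp +contextual [eq_comm]

theorem z_neg_mul_z (k : E →₀ ℤ) :
    z K (-k) * z K k = coeff K (∏ e ∈ k.support, factor K e (k e)) := by
  have h1 : z K (-k) = k.support.noncommProd (fun e => zgen K e (-(k e)))
      (zgen_pairwise K _ fun e => -(k e)) :=
    Finset.noncommProd_congr (Finsupp.support_neg k) (fun _ _ => rfl) _
  rw [h1, z, ← Finset.noncommProd_mul_distrib]
  · rw [← Finset.noncommProd_eq_prod]
    exact (Finset.noncommProd_congr rfl (fun e _ => zgen_neg_mul_zgen K e (k e)) _).trans
      (Finset.map_noncommProd k.support (fun e => factor K e (k e))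
        (fun _ _ _ _ _ => Commute.all _ _) (coeff K)).symm
  · exact fun _ _ _ _ h => zgen_commute K h _ _

theorem z_mul_z_neg (k : E →₀ ℤ) :
    z K k * z K (-k) = coeff K (shift K k (∏ e ∈ k.support, factor K e (k e))) := by
  have := z_neg_mul_z K (-k)
  rw [neg_neg] at this
  rw [this, map_prod (shift K k), Finsupp.support_neg]
  congr 1
  exact Finset.prod_congr rfl fun e _ => (shift_factor K k e).symm

theorem zgen_commute_of_mul_nonneg (e : E) {p q : ℤ} (h : 0 ≤ p * q) :
    Commute (zgen K e p) (zgen K e q) := by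
  cases p with
  | ofNat m => cases q with
    | ofNat n => exact (Commute.refl _).pow_pow _ _
    | negSucc n =>
      cases m with
      | zero => simp [zgen]
      | succ m => exact absurd h (not_le.2 (mul_neg_of_pos_of_neg (Int.natCast_succ_pos m)
          (Int.negSucc_lt_zero n)))
  | negSucc m => cases q with
    | negSucc n => exact (Commute.refl _).pow_pow _ _
    | ofNat n =>
      cases n with
      | zero => simp [zgen]
      | succ n => exact absurd h (not_le.2 (mul_neg_of_neg_of_pos (Int.negSucc_lt_zero m)
          (Int.natCast_succ_pos n)))

theorem z_commute_of_mul_nonneg {k l : E →₀ ℤ} (h : ∀ e, 0 ≤ k e * l e) :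
    Commute (z K k) (z K l) := by
  refine Finset.noncommProd_commute _ _ _ _ fun i _ => (Finset.noncommProd_commute _ _ _ _
    fun j _ => ?_).symm
  by_cases hij : i = j
  · subst hij; exact (zgen_commute_of_mul_nonneg K i (h i)).symm
  · exact zgen_commute K hij _ _

/-! The homogeneous components of the Weyl algebra consist of the elements `f(u) z^k`, and
`f(u) z^k w = 0` implies `f = 0` for each word `w`. -/

theorem z_split (k : E →₀ ℤ) (e : E) : z K k = zgen K e (k e) * z K (k.erase e) := by
  classical
  by_cases he : e ∈ k.support
  · rw [z, ← Finset.mul_noncommProd_erase k.support he]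
    congr 1
    exact Finset.noncommProd_congr (Finsupp.support_erase).symm
      (fun i hi => by rw [Finsupp.erase_ne (by rintro rfl; simp at hi)]) _
  · rw [Finsupp.erase_of_notMem_support he, Finsupp.notMem_support_iff.1 he]
    simp [zgen]

theorem x_mul_z (k : E →₀ ℤ) (e : E) :
    ∃ q, x K e * z K k = coeff K q * z K (Finsupp.single e 1 + k) := by
  have h : (Finsupp.single e 1 + k).erase e = k.erase e := by
    rw [Finsupp.erase_add, Finsupp.erase_single, zero_add]
  rw [z_split K k e, z_split K (Finsupp.single e 1 + k) e, h, ← mul_assoc, Finsupp.add_apply,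
    Finsupp.single_eq_same]
  generalize k e = p
  cases p with
  | ofNat n =>
    refine ⟨1, ?_⟩
    rw [show (1 : ℤ) + Int.ofNat n = Int.ofNat (n + 1) by simp [add_comm]]
    simp only [zgen, map_one, one_mul, pow_succ']
  | negSucc n =>
    refine ⟨MvPolynomial.X e - 1, ?_⟩
    have : zgen K e (1 + Int.negSucc n) = y K e ^ n := by
      cases n with
      | zero => simp [zgen, Int.negSucc_eq]
      | succ n =>
        rw [show (1 : ℤ) + Int.negSucc (n + 1) = Int.negSucc n by simp [Int.negSucc_eq]]
        rfl
    rw [this, zgen, pow_succ', ← mul_assoc (x K e), x_mul_y, map_sub, coeff_X, map_one]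
    simp only [mul_assoc]

theorem y_mul_z (k : E →₀ ℤ) (e : E) :
    ∃ q, y K e * z K k = coeff K q * z K (-Finsupp.single e 1 + k) := by
  have h : (-Finsupp.single e 1 + k).erase e = k.erase e := by
    rw [Finsupp.erase_add, ← Finsupp.single_neg, Finsupp.erase_single, zero_add]
  rw [z_split K k e, z_split K (-Finsupp.single e 1 + k) e, h, ← mul_assoc, Finsupp.add_apply,
    Finsupp.neg_apply, Finsupp.single_eq_same]
  generalize k e = p
  cases p with
  | ofNat n =>
    cases n with
    | zero => 
      refine ⟨1, ?_⟩
      rw [show (-1 : ℤ) + Int.ofNat 0 = Int.negSucc 0 from rfl]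
      simp [zgen]
    | succ n =>
      refine ⟨MvPolynomial.X e, ?_⟩
      rw [show (-1 : ℤ) + Int.ofNat (n + 1) = Int.ofNat n by simp]
      simp only [zgen, coeff_X, u, pow_succ', mul_assoc]
  | negSucc n =>
    refine ⟨1, ?_⟩
    rw [show (-1 : ℤ) + Int.negSucc n = Int.negSucc (n + 1) by simp [Int.negSucc_eq]]
    simp only [zgen, map_one, one_mul, pow_succ', mul_assoc]

theorem gen_mul_z (g : WeylGen E) (k : E →₀ ℤ) :
    ∃ q, gen K g * z K k = coeff K q * z K (genDeg g + k) := by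
  cases g with
  | x e => exact x_mul_z K k e
  | y e => exact y_mul_z K k e

/-- A generator can be moved to the right past coefficients, at the cost of changing them. -/
theorem gen_mul_coeff (g : WeylGen E) (r : MvPolynomial E K) :
    ∃ r', gen K g * coeff K r = coeff K r' * gen K g := by
  have h : gen K g = z K (genDeg g) := by
    cases g with
    | x e =>
      rw [genDeg, z_split K _ e, Finsupp.single_eq_same, Finsupp.erase_single]
      simp [z_zero, show zgen K e 1 = x K e from pow_one _, x]
    | y e =>
      rw [genDeg, z_split K _ e, ← Finsupp.single_neg, Finsupp.single_eq_same, Finsupp.erase_single]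
      simp [z_zero, show zgen K e (-1) = y K e from pow_one _, y]
  rw [h]
  exact ⟨_, z_mul_coeff K _ r⟩

theorem word_eq (l : List (WeylGen E)) :
    ∃ q, (l.map (gen K)).prod = coeff K q * z K (l.map genDeg).sum := by
  induction l with
  | nil => exact ⟨1, by simp [z_zero]⟩
  | cons g l ih =>
    obtain ⟨q, hq⟩ := ih
    obtain ⟨q', hq'⟩ := gen_mul_coeff K g q
    obtain ⟨r, hr⟩ := gen_mul_z K g (l.map genDeg).sum
    refine ⟨q' * r, ?_⟩
    rw [List.map_cons, List.prod_cons, hq, ← mul_assoc, hq', mul_assoc, hr, List.map_cons,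
      List.sum_cons, map_mul, mul_assoc]

theorem exists_eq_of_mem_part {k : E →₀ ℤ} {a : Weyl K E} (ha : a ∈ part K k) :
    ∃ q, a = coeff K q * z K k := by
  induction ha using Submodule.span_induction with
  | mem a h =>
    obtain ⟨l, hl, rfl⟩ := h
    rw [← hl]
    exact word_eq K l
  | zero => exact ⟨0, by simp⟩
  | add a b _ _ ha hb =>
    obtain ⟨p, rfl⟩ := ha
    obtain ⟨q, rfl⟩ := hb
    exact ⟨p + q, by rw [map_add, add_mul]⟩
  | smul c a _ ha =>
    obtain ⟨p, rfl⟩ := ha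
    exact ⟨c • p, by rw [map_smul, smul_mul_assoc]⟩

/-- The action of the Weyl algebra on `K[u_e | e ∈ E]` where `x_e` acts by the shift
`u_e ↦ u_e - 1`, and `y_e` by the inverse shift followed by multiplication by `u_e`. -/
def rep : Weyl K E →ₐ[K] Module.End K (MvPolynomial E K) :=
  RingQuot.liftAlgHom K ⟨FreeAlgebra.lift K fun
    | .x e => (shift K (Finsupp.single e 1)).toLinearMap
    | .y e => (LinearMap.mulLeft K (MvPolynomial.X e)).comp
        (shift K (-(Finsupp.single e 1 : E →₀ ℤ) : E →₀ ℤ)).toLinearMap, by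
    intro a b h
    have hs (c d : E → ℤ) (r : MvPolynomial E K) : shift K c (shift K d r) = shift K (c + d) r := by
      rw [← shift_comp]; rfl
    cases h with
    | x_x i j =>
      refine LinearMap.ext fun r => ?_
      simp [hs, add_comm]
    | y_y i j =>
      refine LinearMap.ext fun r => ?_
      by_cases hij : i = j
      · subst hij; rfl
      · simp [hs, add_comm, Ne.symm hij, hij]
        ring
    | y_x_self i =>
      refine LinearMap.ext fun r => ?_
      simp [hs, shift_zero]
      ring
    | y_x_ne i j hij =>
      refine LinearMap.ext fun r => ?_
      simp [hs, hij, add_comm]⟩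

theorem rep_coeff (p r : MvPolynomial E K) : rep K (coeff K p) r = p * r := by
  have : (rep K).comp (coeff K) = Algebra.lmul K (MvPolynomial E K) := by
    apply MvPolynomial.algHom_ext
    intro e
    refine LinearMap.ext fun r => ?_
    have hs (c d : E → ℤ) (r : MvPolynomial E K) : shift K c (shift K d r) = shift K (c + d) r := by
      rw [← shift_comp]; rfl
    simp [u, x, y, gen, rep, hs, shift_zero]
  exact LinearMap.congr_fun (DFunLike.congr_fun this p) r

theorem shift_injective (c : E → ℤ) : Function.Injective (shift K c) :=
  (shiftEquiv K c).injective

theorem rep_x_injective (e : E) : Function.Injective (rep K (x K e)) := by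
  have : (rep K (x K e) : MvPolynomial E K → MvPolynomial E K) =
      shift K (Finsupp.single e 1 : E →₀ ℤ) := by
    funext r; simp [x, gen, rep]
  rw [this]
  exact shift_injective K _

theorem rep_y_injective [IsDomain K] (e : E) : Function.Injective (rep K (y K e)) := by
  have : (rep K (y K e) : MvPolynomial E K → MvPolynomial E K) =
      fun r => MvPolynomial.X e * shift K (-(Finsupp.single e 1 : E →₀ ℤ) : E →₀ ℤ) r := by
    funext r; simp [y, gen, rep]
  rw [this]
  exact (mul_right_injective₀ (MvPolynomial.X_ne_zero e)).comp (shift_injective K _)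

theorem rep_z_injective [IsDomain K] (k : E →₀ ℤ) : Function.Injective (rep K (z K k)) := by
  have hpow (f : Module.End K (MvPolynomial E K)) (hf : Function.Injective f) (n : ℕ) :
      Function.Injective (f ^ n : Module.End K (MvPolynomial E K)) := by
    rw [Module.End.coe_pow]
    exact hf.iterate n
  refine Finset.noncommProd_induction _ _ _ (fun a => Function.Injective (rep K a)) ?_ ?_ ?_
  · intro a b ha hb
    rw [map_mul]
    exact ha.comp hb
  · rw [map_one]
    exact Function.injective_id
  · intro e _
    cases k e with
    | ofNat n => rw [zgen, map_pow]; exact hpow _ (rep_x_injective K e) n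
    | negSucc n => rw [zgen, map_pow]; exact hpow _ (rep_y_injective K e) (n + 1)

theorem eq_zero_of_mul_eq_zero [IsDomain K] {k : E →₀ ℤ} {a b : Weyl K E} (ha : a ∈ part K k)
    (hb : Function.Injective (rep K b)) (h : a * b = 0) : a = 0 := by
  obtain ⟨q, rfl⟩ := exists_eq_of_mem_part K ha
  have h1 : rep K (coeff K q * z K k * b) 1 = q * rep K (z K k) (rep K b 1) := by
    rw [map_mul, map_mul, Module.End.mul_apply, Module.End.mul_apply, rep_coeff]
  rw [h, map_zero, LinearMap.zero_apply] at h1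
  have h2 : rep K (z K k) (rep K b 1) ≠ 0 := by
    intro h0
    have h3 := hb (((rep_z_injective K k) (h0.trans (map_zero _).symm)).trans (map_zero _).symm)
    exact one_ne_zero h3
  rw [(mul_eq_zero.1 h1.symm).resolve_right h2, map_zero, zero_mul]

theorem x_mem_part (e : E) : x K e ∈ part K (Finsupp.single e 1 : E →₀ ℤ) :=
  Submodule.subset_span ⟨[.x e], by simp [genDeg], by simp [x]⟩

theorem y_mem_part (e : E) : y K e ∈ part K (-Finsupp.single e 1 : E →₀ ℤ) :=
  Submodule.subset_span ⟨[.y e], by simp [genDeg], by simp [y]⟩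

end Basic

end Weyl

theorem one_mem_gradedPart {K A G ι : Type*} [CommSemiring K] [Semiring A] [Algebra K A]
    [AddMonoid ι] (gen : G → A) (deg : G → ι) : 1 ∈ gradedPart K gen deg 0 :=
  Submodule.subset_span ⟨[], by simp, by simp⟩

theorem mul_mem_gradedPart {K A G ι : Type*} [CommSemiring K] [Semiring A] [Algebra K A]
    [AddMonoid ι] (gen : G → A) (deg : G → ι) {d d' : ι} {a b : A}
    (ha : a ∈ gradedPart K gen deg d) (hb : b ∈ gradedPart K gen deg d') :
    a * b ∈ gradedPart K gen deg (d + d') := by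
  have h := Submodule.mul_mem_mul ha hb
  rw [gradedPart, gradedPart, Submodule.span_mul_span] at h
  refine Submodule.span_mono ?_ h
  rintro _ ⟨_, ⟨l, hl, rfl⟩, _, ⟨l', hl', rfl⟩, rfl⟩
  exact ⟨l ++ l', by simp [hl, hl'], by simp⟩

namespace Weyl

variable (K : Type*) {E : Type*} [CommRing K]

theorem coeff_mem_part (r : MvPolynomial E K) : coeff K r ∈ part K (0 : E →₀ ℤ) := by
  induction r using MvPolynomial.induction_on with
  | C a =>
    rw [← MvPolynomial.algebraMap_eq, AlgHom.commutes, Algebra.algebraMap_eq_smul_one]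
    exact Submodule.smul_mem _ _ (one_mem_gradedPart _ _)
  | add p q hp hq => rw [map_add]; exact add_mem hp hq
  | mul_X p e hp =>
    rw [map_mul, coeff_X, u]
    have := mul_mem_gradedPart _ _ hp (mul_mem_gradedPart _ _ (y_mem_part K e) (x_mem_part K e))
    simpa [part] using this

theorem zgen_mem_part (e : E) (p : ℤ) : zgen K e p ∈ part K (Finsupp.single e p : E →₀ ℤ) := by
  have hx (n : ℕ) : x K e ^ n ∈ part K (Finsupp.single e (n : ℤ) : E →₀ ℤ) := by
    induction n with
    | zero => simpa [part] using one_mem_gradedPart (gen K) genDeg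
    | succ n ih =>
      rw [pow_succ, Nat.cast_succ, Finsupp.single_add]
      exact mul_mem_gradedPart _ _ ih (x_mem_part K e)
  have hy (n : ℕ) : y K e ^ n ∈ part K (Finsupp.single e (-(n : ℤ)) : E →₀ ℤ) := by
    induction n with
    | zero => simpa [part] using one_mem_gradedPart (gen K) genDeg
    | succ n ih =>
      rw [pow_succ, Nat.cast_succ, neg_add, Finsupp.single_add, Finsupp.single_neg e (1 : ℤ)]
      exact mul_mem_gradedPart _ _ ih (y_mem_part K e)
  cases p with
  | ofNat n => exact hx n
  | negSucc n => exact hy (n + 1)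

theorem z_mem_part (k : E →₀ ℤ) : z K k ∈ part K k := by
  classical
  induction k using Finsupp.induction with
  | zero => rw [z_zero]; exact one_mem_gradedPart _ _
  | single_add e p k hk _ ih =>
    have h : (Finsupp.single e p + k).erase e = k := by
      rw [Finsupp.erase_add, Finsupp.erase_single, zero_add, Finsupp.erase_of_notMem_support hk]
    rw [z_split K _ e, h, Finsupp.add_apply, Finsupp.notMem_support_iff.1 hk, add_zero,
      Finsupp.single_eq_same]
    exact mul_mem_gradedPart _ _ (zgen_mem_part K e p) ih

end Weyl

/-! ### Multiquivers -/

/-- A multiquiver with vertex set `V` and edge set `E`. The value `none` means that the edge has no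
source (respectively no target). -/
structure Multiquiver (V E : Type*) where
  s : E → Option (V × ℕ+)
  t : E → Option (V × ℕ+)
  no_loops : ∀ e a b m n, s e = some (a, m) → t e = some (b, n) → a ≠ b
  finite_s : ∀ v, {e | ∃ n, s e = some (v, n)}.Finite
  finite_t : ∀ v, {e | ∃ n, t e = some (v, n)}.Finite

namespace Multiquiver

variable {V E : Type*} (Γ : Multiquiver V E)

open Classical in
/-- The multiplicity at the vertex `v` of an edge end `o`; it is zero if the end is not at `v`. -/
def mult : Option (V × ℕ+) → V → ℕ
  | some (w, n), v => if w = v then (n : ℕ) else 0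
  | none, _ => 0

theorem mult_ne_zero {o : Option (V × ℕ+)} {v : V} : mult o v ≠ 0 ↔ ∃ n, o = some (v, n) := by
  rcases o with _ | ⟨w, n⟩
  · simp [mult]
  · by_cases h : w = v <;> simp [mult, h]

/-- The set of edges incident to `v`. -/
def incident (v : V) : Set E := {e | ∃ n, Γ.s e = some (v, n)} ∪ {e | ∃ n, Γ.t e = some (v, n)}

theorem finite_incident (v : V) : (Γ.incident v).Finite := (Γ.finite_s v).union (Γ.finite_t v)

/-- The matrix entry `γ_{ev}`. -/
def entry (e : E) (v : V) : ℤ := (mult (Γ.t e) v : ℤ) - (mult (Γ.s e) v : ℤ)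

theorem entry_support_finite (v : V) : (Function.support fun e => Γ.entry e v).Finite := by
  refine (Γ.finite_incident v).subset fun e he => ?_
  by_contra h
  simp only [incident, Set.mem_union, Set.mem_ofPred_eq, ← mult_ne_zero, not_or, not_not] at h
  exact he (by simp [entry, h.1, h.2])

/-- The column `γ(v) ∈ ℤE` of the incidence matrix. -/
def col (v : V) : E →₀ ℤ :=
  Finsupp.ofSupportFinite (fun e => Γ.entry e v) (Γ.entry_support_finite v)

/-- The incidence matrix `γ : ℤV → ℤE`. -/
def γ : (V →₀ ℤ) →ₗ[ℤ] (E →₀ ℤ) := Finsupp.linearCombination ℤ Γ.col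

/-- The polynomial `u_{ev}`: it is `u_e (u_e + 1) ⋯ (u_e + n - 1)` if `t(e) = (v, n)` and
`(u_e - 1) (u_e - 2) ⋯ (u_e - n)` if `s(e) = (v, n)`. At most one of the two factors below is
different from `1`. -/
def uev (K : Type*) [CommRing K] (e : E) (v : V) : MvPolynomial E K :=
  (∏ i ∈ Finset.range (mult (Γ.t e) v), (MvPolynomial.X e + (i : MvPolynomial E K))) *
    ∏ i ∈ Finset.range (mult (Γ.s e) v), (MvPolynomial.X e - ((i + 1 : ℕ) : MvPolynomial E K))

/-- The element `t_v`, the product of the `u_{ev}` over the edges `e` incident to `v`. -/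
def tv (K : Type*) [CommRing K] (v : V) : MvPolynomial E K :=
  ∏ e ∈ (Γ.finite_incident v).toFinset, Γ.uev K e v

theorem mult_t_eq_zero_or (e : E) (v : V) : mult (Γ.t e) v = 0 ∨ mult (Γ.s e) v = 0 := by
  by_contra h
  rw [not_or] at h
  obtain ⟨n, hn⟩ := mult_ne_zero.1 h.1
  obtain ⟨m, hm⟩ := mult_ne_zero.1 h.2
  exact Γ.no_loops e v v m n hm hn rfl

theorem uev_eq_factor (K : Type*) [CommRing K] (e : E) (v : V) :
    Γ.uev K e v = Weyl.factor K e (Γ.entry e v) := by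
  rcases Γ.mult_t_eq_zero_or e v with h | h
  · rw [uev, entry, h]
    cases mult (Γ.s e) v with
    | zero =>
      change _ = Weyl.factor K e (Int.ofNat 0)
      simp [Weyl.factor]
    | succ n =>
      rw [show ((0 : ℕ) : ℤ) - ((n + 1 : ℕ) : ℤ) = Int.negSucc n by simp [Int.negSucc_eq]]
      simp [Weyl.factor]
  · rw [uev, entry, h]
    simp [Weyl.factor]

theorem col_support (v : V) : (Γ.col v).support = (Γ.finite_incident v).toFinset := by
  ext e
  simp only [Finsupp.mem_support_iff, Set.Finite.mem_toFinset, incident, Set.mem_union,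
    Set.mem_ofPred_eq, ← mult_ne_zero]
  change Γ.entry e v ≠ 0 ↔ _
  rcases Γ.mult_t_eq_zero_or e v with h | h <;> simp [entry, h]

theorem tv_eq (K : Type*) [CommRing K] (v : V) :
    Γ.tv K v = ∏ e ∈ (Γ.col v).support, Weyl.factor K e (Γ.col v e) := by
  rw [tv, col_support]
  exact Finset.prod_congr rfl fun e _ => Γ.uev_eq_factor K e v

theorem tv_ne_zero (K : Type*) [Field K] (v : V) : Γ.tv K v ≠ 0 := by
  have h (e : E) (a : K) : (MvPolynomial.X e + MvPolynomial.C a : MvPolynomial E K) ≠ 0 := by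
    intro h0
    have := congrArg (MvPolynomial.eval fun _ => 1 - a) h0
    simp at this
  refine Finset.prod_ne_zero_iff.2 fun e _ => mul_ne_zero (Finset.prod_ne_zero_iff.2 fun i _ => ?_)
    (Finset.prod_ne_zero_iff.2 fun i _ => ?_)
  · simpa using h e (i : K)
  · simpa [sub_eq_add_neg] using h e (-((i + 1 : ℕ) : K))

/-- The twisted generalized Weyl datum `(R_E, σ^Γ, t^Γ)` with `σ_v(u_e) = u_e - γ_{ev}`. -/
def datum (K : Type*) [Field K] : TGWDatum K (MvPolynomial E K) V where
  σ v := Weyl.shiftEquiv K (Γ.col v)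
  σ_comm v w := AlgEquiv.ext fun r => by
    change ((Weyl.shift K _).comp (Weyl.shift K _)) r = ((Weyl.shift K _).comp (Weyl.shift K _)) r
    rw [Weyl.shift_comp, Weyl.shift_comp, add_comm]
  t := Γ.tv K
  t_central v := by simp
  t_ne_zero := Γ.tv_ne_zero K

/-- The matrix `μ` with all entries equal to `1`. -/
def μ (V K : Type*) [Field K] : V → V → K := fun _ _ => 1

/-- The twisted generalized Weyl algebra `A(Γ)`. -/
abbrev Alg (K : Type*) [Field K] : Type _ := (Γ.datum K).Alg (μ V K)

/-- The homogeneous component `A(Γ)_g`. -/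
abbrev algPart (K : Type*) [Field K] (g : V →₀ ℤ) : Submodule K (Γ.Alg K) :=
  (Γ.datum K).algPart (μ V K) g

/-- The generator `X_v` of `A(Γ)`. -/
def X (K : Type*) [Field K] (v : V) : Γ.Alg K :=
  (Γ.datum K).toAlg (μ V K) ((Γ.datum K).gen (μ V K) (.X v))

/-- The generator `Y_v` of `A(Γ)`. -/
def Y (K : Type*) [Field K] (v : V) : Γ.Alg K :=
  (Γ.datum K).toAlg (μ V K) ((Γ.datum K).gen (μ V K) (.Y v))

/-- The image `ρ(r)` in `A(Γ)` of `r ∈ R_E`. -/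
def coeff (K : Type*) [Field K] (r : MvPolynomial E K) : Γ.Alg K :=
  (Γ.datum K).toAlg (μ V K) ((Γ.datum K).gen (μ V K) (.coeff r))

/-! ### The representation `φ_Γ` -/

/-- The images in the Weyl algebra of the generators. -/
def φGen (K : Type*) [Field K] : TGWGen (MvPolynomial E K) V → Weyl K E
  | .coeff r => Weyl.coeff K r
  | .X v => Weyl.z K (Γ.col v)
  | .Y v => Weyl.z K (-Γ.col v)

theorem col_mul_col_nonpos {v w : V} (h : v ≠ w) (e : E) : Γ.col v e * Γ.col w e ≤ 0 := by
  change Γ.entry e v * Γ.entry e w ≤ 0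
  have h0 (o : Option (V × ℕ+)) : mult o v = 0 ∨ mult o w = 0 := by
    by_contra hc
    rw [not_or] at hc
    obtain ⟨n, hn⟩ := mult_ne_zero.1 hc.1
    obtain ⟨m, hm⟩ := mult_ne_zero.1 hc.2
    rw [hn] at hm
    simp only [Option.some.injEq, Prod.mk.injEq] at hm
    exact h hm.1
  rcases h0 (Γ.t e) with h1 | h1 <;> rcases h0 (Γ.s e) with h2 | h2 <;> simp [entry, h1, h2] <;>
    positivity

theorem φGen_rel (K : Type*) [Field K] {a b : FreeAlgebra K (TGWGen (MvPolynomial E K) V)}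
    (h : (Γ.datum K).Rel (μ V K) a b) :
    FreeAlgebra.lift K (Γ.φGen K) a = FreeAlgebra.lift K (Γ.φGen K) b := by
  cases h with
  | coeff_add r s => simp [φGen]
  | coeff_mul r s => simp [φGen]
  | coeff_algebraMap k => simp [φGen, ← MvPolynomial.algebraMap_eq]
  | X_coeff v r =>
    simp only [map_mul, FreeAlgebra.lift_ι_apply, φGen]
    exact Weyl.z_mul_coeff K (Γ.col v) r
  | Y_coeff v r =>
    simp only [map_mul, FreeAlgebra.lift_ι_apply, φGen]
    exact Weyl.z_mul_coeff K (-Γ.col v) r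
  | Y_X v =>
    simp only [map_mul, FreeAlgebra.lift_ι_apply, φGen]
    rw [Weyl.z_neg_mul_z]
    exact congrArg _ (Γ.tv_eq K v).symm
  | X_Y v =>
    simp only [map_mul, FreeAlgebra.lift_ι_apply, φGen]
    rw [Weyl.z_mul_z_neg, ← tv_eq]
    rfl
  | X_Y_ne v w h =>
    simp only [map_mul, FreeAlgebra.lift_ι_apply, φGen, μ, one_smul]
    refine Weyl.z_commute_of_mul_nonneg K fun e => ?_
    have := Γ.col_mul_col_nonpos h e
    rw [Finsupp.neg_apply, mul_neg]
    linarith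

/-- The homomorphism from the twisted generalized Weyl construction to the Weyl algebra which
induces `φ_Γ`. -/
def φConstruction (K : Type*) [Field K] : (Γ.datum K).Construction (μ V K) →ₐ[K] Weyl K E :=
  RingQuot.liftAlgHom K ⟨FreeAlgebra.lift K (Γ.φGen K), fun _ _ h => Γ.φGen_rel K h⟩

theorem φConstruction_gen (K : Type*) [Field K] (a : TGWGen (MvPolynomial E K) V) :
    Γ.φConstruction K ((Γ.datum K).gen (μ V K) a) = Γ.φGen K a := by
  simp [φConstruction, TGWDatum.gen]

theorem γ_single (v : V) : Γ.γ (Finsupp.single v 1) = Γ.col v := by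
  simp [γ]

theorem φGen_mem_part (K : Type*) [Field K] (a : TGWGen (MvPolynomial E K) V) :
    Γ.φGen K a ∈ Weyl.part K (Γ.γ (TGWDatum.genDeg a)) := by
  cases a with
  | coeff r => rw [TGWDatum.genDeg, map_zero]; exact Weyl.coeff_mem_part K r
  | X v => rw [TGWDatum.genDeg, γ_single]; exact Weyl.z_mem_part K _
  | Y v => rw [TGWDatum.genDeg, map_neg, γ_single]; exact Weyl.z_mem_part K _

theorem φConstruction_mem_part (K : Type*) [Field K] {g : V →₀ ℤ}
    {a : (Γ.datum K).Construction (μ V K)} (ha : a ∈ (Γ.datum K).constructionPart (μ V K) g) :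
    Γ.φConstruction K a ∈ Weyl.part K (Γ.γ g) := by
  induction ha using Submodule.span_induction with
  | mem a h =>
    obtain ⟨l, rfl, rfl⟩ := h
    induction l with
    | nil => simpa [Weyl.part] using one_mem_gradedPart (Weyl.gen K) Weyl.genDeg
    | cons b l ih =>
      rw [List.map_cons, List.map_cons, List.prod_cons, List.sum_cons, map_mul, map_add,
        φConstruction_gen]
      exact mul_mem_gradedPart _ _ (Γ.φGen_mem_part K b) ih
  | zero => rw [map_zero]; exact zero_mem _
  | add a b _ _ ha hb => rw [map_add]; exact add_mem ha hb
  | smul c a _ ha => rw [map_smul]; exact Submodule.smul_mem _ _ ha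

/-- Each component of the construction contains a monomial which acts injectively. -/
theorem exists_monomial (K : Type*) [Field K] (g : V →₀ ℤ) :
    ∃ b ∈ (Γ.datum K).constructionPart (μ V K) g,
      Function.Injective (Weyl.rep K (Γ.φConstruction K b)) := by
  classical
  have hmul (g h : V →₀ ℤ) : (∃ b ∈ (Γ.datum K).constructionPart (μ V K) g,
      Function.Injective (Weyl.rep K (Γ.φConstruction K b))) →
      (∃ b ∈ (Γ.datum K).constructionPart (μ V K) h,
      Function.Injective (Weyl.rep K (Γ.φConstruction K b))) →
      (∃ b ∈ (Γ.datum K).constructionPart (μ V K) (g + h),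
      Function.Injective (Weyl.rep K (Γ.φConstruction K b))) := by
    rintro ⟨a, ha, ha'⟩ ⟨b, hb, hb'⟩
    refine ⟨a * b, mul_mem_gradedPart _ _ ha hb, ?_⟩
    rw [map_mul, map_mul]
    exact ha'.comp hb'
  have h0 : ∃ b ∈ (Γ.datum K).constructionPart (μ V K) 0,
      Function.Injective (Weyl.rep K (Γ.φConstruction K b)) :=
    ⟨1, one_mem_gradedPart _ _, by rw [map_one, map_one]; exact Function.injective_id⟩
  induction g using Finsupp.induction with
  | zero => exact h0
  | single_add v p g _ hp ih =>
    refine hmul _ _ ?_ ih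
    clear hp
    induction p using Int.induction_on with
    | zero => simpa using h0
    | succ n ih =>
      rw [Finsupp.single_add]
      refine hmul _ _ ih ⟨(Γ.datum K).gen (μ V K) (.X v), Submodule.subset_span
        ⟨[.X v], by simp [TGWDatum.genDeg], by simp⟩, ?_⟩
      rw [φConstruction_gen]
      exact Weyl.rep_z_injective K _
    | pred n ih =>
      rw [sub_eq_add_neg, Finsupp.single_add]
      refine hmul _ _ ih ⟨(Γ.datum K).gen (μ V K) (.Y v), Submodule.subset_span
        ⟨[.Y v], by simp [TGWDatum.genDeg], by simp⟩, ?_⟩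
      rw [φConstruction_gen]
      exact Weyl.rep_z_injective K _

theorem radical_le_ker (K : Type*) [Field K] :
    (Γ.datum K).radical (μ V K) ≤ TwoSidedIdeal.ker (Γ.φConstruction K) := by
  refine sSup_le fun J hJ a ha => ?_
  rw [TwoSidedIdeal.mem_ker]
  have h := hJ.1 a ha
  clear ha
  induction h using Submodule.span_induction with
  | mem b hb =>
    obtain ⟨hbJ, g, hbg⟩ := hb
    obtain ⟨c, hc, hc'⟩ := Γ.exists_monomial K (-g)
    refine Weyl.eq_zero_of_mul_eq_zero K (Γ.φConstruction_mem_part K hbg) hc' ?_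
    rw [← map_mul, hJ.2 (b * c) (J.mul_mem_right _ _ hbJ), map_zero]
    have := mul_mem_gradedPart _ _ hbg hc
    rwa [add_neg_cancel] at this
  | zero => exact map_zero _
  | add b c _ _ hb hc => rw [map_add, hb, hc, add_zero]
  | smul k b _ hb => rw [map_smul, hb, smul_zero]

/-- The canonical representation `φ_Γ : A(Γ) → A_E(K)`. -/
def φ (K : Type*) [Field K] : Γ.Alg K →ₐ[K] Weyl K E :=
  ((Γ.datum K).radical (μ V K)).ringCon.liftₐ (Γ.φConstruction K)
    fun a b h => sub_eq_zero.1 <| by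
      rw [← map_sub]
      exact (TwoSidedIdeal.mem_ker _).1 (Γ.radical_le_ker K (((Γ.datum K).radical (μ V K)).rel_iff a b |>.1 h))

theorem φ_X (K : Type*) [Field K] (v : V) : Γ.φ K (Γ.X K v) = Weyl.z K (Γ.γ (.single v 1)) := by
  rw [γ_single]
  exact Γ.φConstruction_gen K (.X v)

theorem φ_Y (K : Type*) [Field K] (v : V) : Γ.φ K (Γ.Y K v) = Weyl.z K (-Γ.γ (.single v 1)) := by
  rw [γ_single]
  exact Γ.φConstruction_gen K (.Y v)

theorem φ_u (K : Type*) [Field K] (e : E) :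
    Γ.φ K (Γ.coeff K (MvPolynomial.X e)) = Weyl.y K e * Weyl.x K e :=
  (Γ.φConstruction_gen K (.coeff (MvPolynomial.X e))).trans (Weyl.coeff_X K e)

/-- `φ_Γ` is locally surjective if `φ_Γ(A(Γ)_g) = A_E(K)_{γ(g)}` for all `g ∈ ℤV`. -/
def IsLocallySurjective (K : Type*) [Field K] : Prop :=
  ∀ g : V →₀ ℤ, (Γ.algPart K g).map (Γ.φ K).toLinearMap = Weyl.part K (Γ.γ g)

/-! ### Cycles in the underlying undirected graph -/

/-- The proper edge `e` has the two endpoints `a` and `b`, irrespective of its direction. -/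
def Joins (e : E) (a b : V) : Prop :=
  (∃ m n, Γ.s e = some (a, m) ∧ Γ.t e = some (b, n)) ∨
    (∃ m n, Γ.s e = some (b, m) ∧ Γ.t e = some (a, n))

/-- The underlying undirected graph is acyclic: there are no pairwise distinct vertices
`v_0, …, v_n` and pairwise distinct edges `e_0, …, e_n` such that `e_i` joins `v_i` and `v_{i+1}`,
with indices modulo `n + 1`. Two edges between the same two vertices form a cycle. -/
def IsAcyclic : Prop :=
  ¬ ∃ (n : ℕ) (v : Fin (n + 1) → V) (e : Fin (n + 1) → E),
    Function.Injective v ∧ Function.Injective e ∧ ∀ i, Γ.Joins (e i) (v i) (v (i + 1))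

end Multiquiver

end MultiquiverTGW

end

/-!
In the Weyl algebra `z^k z^l = f(u) z^{k + l}`, where `f` has a factor `u_e - d` whenever the walk
with steps `l_e` and `k_e` that ends at `d` crosses the wall between `0` and `1` and returns. Hence
`φ_Γ(A(Γ)_g) = I_g z^{γ(g)}` for an ideal `I_g` of `R_E`, and local surjectivity says that `1 ∈ I_g`
for all `g`.

If `Γ` is acyclic, some vertex `v` in the support of `g` shares at most one edge with the rest of
the support. Writing `g = p v + h`, the products `z^{γ(pv)} z^{γ(h)}` and `z^{γ(h)} z^{γ(pv)}` then
have coprime coefficients, so `1 ∈ I_g` follows by induction on the support.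

If `v_0, …, v_n` is a cycle, a starting point on each of its edges can be chosen such that the walk
of any word of degree `v_0 + ⋯ + v_n` has to cross some wall and cross it back. All coefficients of
such words therefore vanish at the common endpoint of these walks, so `I_g` is proper for
`g = v_0 + ⋯ + v_n`.
-/

noncomputable section

namespace MultiquiverTGW

/-! ### Products of monomials in the Weyl algebra -/

namespace Weyl

open Finset Polynomial

/-- The positions `d` such that the walk `d - p - q`, `d - p`, `d` on `ℤ` starts and ends on the
same side of the wall between `0` and `1`, with its middle stop on the other side. -/
def crossings (p q : ℤ) : Finset ℤ :=
  Ioc (max 0 (p + q)) p ∪ Ioc p (min 0 (p + q))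

theorem mem_crossings {p q d : ℤ} :
    d ∈ crossings p q ↔ ¬(0 < d ↔ 0 < d - p) ∧ (0 < d ↔ 0 < d - p - q) := by
  simp only [crossings, mem_union, mem_Ioc]
  omega

theorem disjoint_crossings (p q : ℤ) : Disjoint (crossings p q) (crossings q p) := by
  simp only [disjoint_left, mem_crossings]
  omega

theorem crossings_of_mul_nonneg {p q : ℤ} (h : 0 ≤ p * q) : crossings p q = ∅ := by
  simp only [eq_empty_iff_forall_notMem, mem_crossings]
  rcases mul_nonneg_iff.1 h with ⟨hp, hq⟩ | ⟨hp, hq⟩ <;> omega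

theorem crossings_add_one_of_neg {p q : ℤ} (hp : 0 ≤ p) (hq : q < 0) :
    crossings (p + 1) q = insert (p + 1) (crossings p (q + 1)) := by
  ext d
  simp only [mem_insert, mem_crossings]
  omega

theorem crossings_sub_one_of_pos {p q : ℤ} (hp : p ≤ 0) (hq : 0 < q) :
    crossings (p - 1) q = insert p (crossings p (q - 1)) := by
  ext d
  simp only [mem_insert, mem_crossings]
  omega

section CommRing

variable (K : Type*) {E : Type*} [CommRing K]

/-- The polynomial `f` with `z_e^{(p)} z_e^{(q)} = f(u_e) z_e^{(p + q)}`. -/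
def crossingPoly (p q : ℤ) : K[X] := ∏ d ∈ crossings p q, (X - C (d : K))

theorem crossingPoly_of_mul_nonneg {p q : ℤ} (h : 0 ≤ p * q) : crossingPoly K p q = 1 := by
  rw [crossingPoly, crossings_of_mul_nonneg h, prod_empty]

theorem crossingPoly_add_one_of_neg {p q : ℤ} (hp : 0 ≤ p) (hq : q < 0) :
    crossingPoly K (p + 1) q = (X - C ((p + 1 : ℤ) : K)) * crossingPoly K p (q + 1) := by
  rw [crossingPoly, crossings_add_one_of_neg hp hq, prod_insert, crossingPoly]
  rw [mem_crossings]
  omega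

theorem crossingPoly_sub_one_of_pos {p q : ℤ} (hp : p ≤ 0) (hq : 0 < q) :
    crossingPoly K (p - 1) q = (X - C (p : K)) * crossingPoly K p (q - 1) := by
  rw [crossingPoly, crossings_sub_one_of_pos hp hq, prod_insert, crossingPoly]
  rw [mem_crossings]
  omega

theorem eval_crossingPoly_eq_zero {p q d : ℤ} (hd : d ∈ crossings p q) :
    (crossingPoly K p q).eval (d : K) = 0 := by
  rw [crossingPoly, eval_prod]
  exact prod_eq_zero hd (by simp)

theorem zgen_zero (e : E) : zgen K e 0 = 1 := pow_zero _

theorem zgen_neg_natCast (e : E) (n : ℕ) : zgen K e (-(n : ℤ)) = y K e ^ n := by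
  cases n with
  | zero => exact (zgen_zero K e).trans (pow_zero _).symm
  | succ n => rfl

theorem zgen_add_one (e : E) {p : ℤ} (hp : 0 ≤ p) : zgen K e (p + 1) = zgen K e p * x K e := by
  lift p to ℕ using hp
  exact pow_succ _ _

theorem zgen_sub_one (e : E) {p : ℤ} (hp : p ≤ 0) : zgen K e (p - 1) = zgen K e p * y K e := by
  obtain ⟨n, rfl⟩ := Int.exists_eq_neg_ofNat hp
  rw [zgen_neg_natCast, ← pow_succ, ← zgen_neg_natCast, Nat.cast_succ, neg_add, sub_eq_add_neg]

theorem x_mul_zgen_of_nonneg (e : E) {q : ℤ} (hq : 0 ≤ q) :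
    x K e * zgen K e q = zgen K e (q + 1) := by
  lift q to ℕ using hq
  exact (pow_succ' _ _).symm

theorem y_mul_zgen_of_nonpos (e : E) {q : ℤ} (hq : q ≤ 0) :
    y K e * zgen K e q = zgen K e (q - 1) := by
  obtain ⟨n, rfl⟩ := Int.exists_eq_neg_ofNat hq
  rw [zgen_neg_natCast, ← pow_succ', ← zgen_neg_natCast, Nat.cast_succ, neg_add, sub_eq_add_neg]

theorem x_mul_zgen_of_neg (e : E) {q : ℤ} (hq : q < 0) :
    x K e * zgen K e q = (u K e - 1) * zgen K e (q + 1) := by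
  rw [← x_mul_y, mul_assoc, y_mul_zgen_of_nonpos K e (by omega), add_sub_cancel_right]

theorem y_mul_zgen_of_pos (e : E) {q : ℤ} (hq : 0 < q) :
    y K e * zgen K e q = u K e * zgen K e (q - 1) := by
  rw [u, mul_assoc, x_mul_zgen_of_nonneg K e (by omega), sub_add_cancel]

theorem zgen_mul_zgen (e : E) (p q : ℤ) :
    zgen K e p * zgen K e q = aeval (u K e) (crossingPoly K p q) * zgen K e (p + q) := by
  induction p using Int.induction_on generalizing q with
  | zero =>
    rw [crossingPoly_of_mul_nonneg K (zero_mul q).ge, map_one, zero_add, zgen_zero]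
  | succ n ih =>
    have hn : (0 : ℤ) ≤ n := n.cast_nonneg
    rw [zgen_add_one K e hn, mul_assoc, show (n : ℤ) + 1 + q = n + (q + 1) by ring]
    rcases le_or_gt 0 q with hq | hq
    · rw [x_mul_zgen_of_nonneg K e hq, ih, crossingPoly_of_mul_nonneg K (by positivity),
        crossingPoly_of_mul_nonneg K (by positivity)]
    · rw [x_mul_zgen_of_neg K e hq, ← mul_assoc, mul_sub, zgen_mul_u, mul_one, ← sub_one_mul,
        mul_assoc, ih, crossingPoly_add_one_of_neg K hn hq]
      simp [mul_assoc, sub_sub]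
  | pred n ih =>
    have hn : -(n : ℤ) ≤ 0 := neg_nonpos.2 n.cast_nonneg
    rw [zgen_sub_one K e hn, mul_assoc, show -(n : ℤ) - 1 + q = -n + (q - 1) by ring]
    rcases le_or_gt q 0 with hq | hq
    · rw [y_mul_zgen_of_nonpos K e hq, ih, crossingPoly_of_mul_nonneg K,
        crossingPoly_of_mul_nonneg K]
      · exact mul_nonneg_of_nonpos_of_nonpos (by omega) hq
      · exact mul_nonneg_of_nonpos_of_nonpos hn (by omega)
    · rw [y_mul_zgen_of_pos K e hq, ← mul_assoc, zgen_mul_u, mul_assoc, ih,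
        crossingPoly_sub_one_of_pos K hn hq]
      simp [mul_assoc]

/-- The polynomial `f` with `z^k z^l = f(u) z^{k + l}`. -/
def cocycle (k l : E →₀ ℤ) : MvPolynomial E K :=
  k.prod fun e p => aeval (MvPolynomial.X e) (crossingPoly K p (l e))

theorem coeff_aeval_X (e : E) (f : K[X]) :
    coeff K (aeval (MvPolynomial.X e) f) = aeval (u K e) f := by
  rw [← aeval_algHom_apply, coeff_X]

theorem commute_aeval_u_zgen {i j : E} (h : i ≠ j) (f : K[X]) (p : ℤ) :
    Commute (aeval (u K i) f) (zgen K j p) := by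
  induction f using Polynomial.induction_on' with
  | add f g hf hg => rw [map_add]; exact hf.add_left hg
  | monomial n a =>
    rw [aeval_monomial]
    exact (Algebra.commute_algebraMap_left a _).mul_left ((u_zgen_commute K h p).pow_left n)

theorem z_eq_noncommProd {k : E →₀ ℤ} {s : Finset E} (hs : k.support ⊆ s) :
    z K k = s.noncommProd (fun e => zgen K e (k e)) (zgen_pairwise K s k) := by
  classical
  have hone : (s \ k.support).noncommProd (fun e => zgen K e (k e)) (zgen_pairwise K _ k) = 1 := by
    rw [noncommProd_eq_pow_card _ _ _ 1, one_pow]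
    intro e he
    rw [Finsupp.notMem_support_iff.1 (mem_sdiff.1 he).2, zgen_zero]
  rw [← noncommProd_congr (union_sdiff_of_subset hs) (fun _ _ => rfl) (zgen_pairwise K _ k),
    noncommProd_union_of_disjoint disjoint_sdiff, hone, mul_one, z]

theorem pairwise_commute_aeval_u (s : Finset E) (f : E → K[X]) :
    (s : Set E).Pairwise (Function.onFun Commute fun e => aeval (u K e) (f e)) := by
  intro i _ j _ _
  simp only [Function.onFun, ← coeff_aeval_X]
  exact (Commute.all _ _).map (coeff K)

theorem coeff_prod_aeval_X (s : Finset E) (f : E → K[X]) :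
    coeff K (∏ e ∈ s, aeval (MvPolynomial.X e) (f e)) =
      s.noncommProd (fun e => aeval (u K e) (f e)) (pairwise_commute_aeval_u K s f) := by
  rw [← noncommProd_eq_prod]
  refine (map_noncommProd s _ _ (coeff K)).trans ?_
  exact noncommProd_congr rfl (fun e _ => coeff_aeval_X K e (f e)) _

theorem cocycle_eq_prod {k : E →₀ ℤ} (l : E →₀ ℤ) {s : Finset E} (hs : k.support ⊆ s) :
    cocycle K k l = ∏ e ∈ s, aeval (MvPolynomial.X e) (crossingPoly K (k e) (l e)) :=
  k.prod_of_support_subset hs _ fun e _ => by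
    rw [crossingPoly_of_mul_nonneg K (zero_mul _).ge, map_one]

theorem z_mul_z (k l : E →₀ ℤ) : z K k * z K l = coeff K (cocycle K k l) * z K (k + l) := by
  classical
  have hk : k.support ⊆ k.support ∪ l.support := subset_union_left
  rw [z_eq_noncommProd K hk, z_eq_noncommProd K subset_union_right,
    z_eq_noncommProd K Finsupp.support_add, cocycle_eq_prod K l hk, coeff_prod_aeval_X]
  refine (noncommProd_mul_distrib _ _ _ _ fun i _ j _ h => zgen_commute K h _ _).symm.trans
    (Eq.trans ?_ (noncommProd_mul_distrib _ _ _ _ fun i _ j _ h =>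
      (commute_aeval_u_zgen K h.symm _ _).symm))
  exact noncommProd_congr rfl (fun e _ => zgen_mul_zgen K e (k e) (l e)) _

theorem coeff_mul_z_mul_coeff_mul_z (p q : MvPolynomial E K) (k l : E →₀ ℤ) :
    coeff K p * z K k * (coeff K q * z K l) =
      coeff K (p * (shift K k q * cocycle K k l)) * z K (k + l) := by
  rw [mul_assoc, ← mul_assoc (z K k), z_mul_coeff, mul_assoc (coeff K (shift K k q)), z_mul_z]
  simp only [map_mul, mul_assoc]

theorem cocycle_of_mul_nonneg {k l : E →₀ ℤ} (h : ∀ e, 0 ≤ k e * l e) : cocycle K k l = 1 :=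
  prod_eq_one fun e _ => by simp only [crossingPoly_of_mul_nonneg K (h e), map_one]

theorem eval_aeval_X (c : E → K) (e : E) (f : K[X]) :
    MvPolynomial.eval c (aeval (MvPolynomial.X e) f) = f.eval (c e) := by
  rw [← MvPolynomial.coe_aeval_eq_eval, RingHom.coe_coe, ← aeval_algHom_apply,
    MvPolynomial.aeval_X, coe_aeval_eq_eval]

theorem eval_cocycle_eq_zero {k l : E →₀ ℤ} {d : E → ℤ} {e : E}
    (h : d e ∈ crossings (k e) (l e)) :
    MvPolynomial.eval (fun f => (d f : K)) (cocycle K k l) = 0 := by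
  classical
  rw [cocycle_eq_prod K l (subset_insert e _), map_prod]
  refine prod_eq_zero (mem_insert_self e _) ?_
  rw [eval_aeval_X, eval_crossingPoly_eq_zero K h]

theorem eval_shift (c d : E → ℤ) (q : MvPolynomial E K) :
    MvPolynomial.eval (fun e => (c e : K)) (shift K d q) =
      MvPolynomial.eval (fun e => ((c e - d e : ℤ) : K)) q := by
  have h : (MvPolynomial.aeval fun e => (c e : K)).comp (shift K d) =
      MvPolynomial.aeval fun e => ((c e - d e : ℤ) : K) :=
    MvPolynomial.algHom_ext fun e => by simp
  exact DFunLike.congr_fun h q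

theorem coeff_mul_z_injective [IsDomain K] (k : E →₀ ℤ) :
    Function.Injective fun q => coeff K q * z K k := by
  intro p q h
  have hrep : p * rep K (z K k) 1 = q * rep K (z K k) 1 := by
    simpa only [map_mul, Module.End.mul_apply, rep_coeff] using congrArg (rep K · 1) h
  exact mul_right_cancel₀ ((map_ne_zero_iff _ (rep_z_injective K k)).2 one_ne_zero) hrep

end CommRing

section Field

variable (K : Type*) {E : Type*} [Field K] [CharZero K]

theorem isCoprime_crossingPoly (p q : ℤ) :
    IsCoprime (crossingPoly K p q) (crossingPoly K q p) := by
  refine IsCoprime.prod_left fun i hi => IsCoprime.prod_right fun j hj => ?_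
  refine isCoprime_X_sub_C_of_isUnit_sub (sub_ne_zero.2 ?_).isUnit
  exact Int.cast_injective.ne (disjoint_iff_ne.1 (disjoint_crossings p q) i hi j hj)

theorem isCoprime_cocycle {k l : E →₀ ℤ} (h : {e | k e ≠ 0 ∧ l e ≠ 0}.Subsingleton) :
    IsCoprime (cocycle K k l) (cocycle K l k) := by
  refine IsCoprime.prod_left fun i _ => IsCoprime.prod_right fun j _ => ?_
  dsimp only
  by_cases hi : k i = 0 ∨ l i = 0
  · rw [crossingPoly_of_mul_nonneg K (mul_eq_zero.2 hi).ge, map_one]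
    exact isCoprime_one_left
  by_cases hj : l j = 0 ∨ k j = 0
  · rw [crossingPoly_of_mul_nonneg K (mul_eq_zero.2 hj).ge, map_one]
    exact isCoprime_one_right
  obtain rfl : i = j := h (not_or.1 hi) (not_or.1 hj).symm
  exact (isCoprime_crossingPoly K (k i) (l i)).map
    (aeval (MvPolynomial.X i) : K[X] →ₐ[K] MvPolynomial E K).toRingHom

end Field

end Weyl

/-! ### Leaves of acyclic multiquivers -/

theorem exists_neighborSet_inter_subsingleton {V : Type*} {G : SimpleGraph V} (hG : G.IsAcyclic)
    {S : Set V} (hfin : S.Finite) (hne : S.Nonempty) :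
    ∃ v ∈ S, (G.neighborSet v ∩ S).Subsingleton := by
  have := hfin.to_subtype
  have := hne.to_subtype
  obtain ⟨v, _, p, hp, hmax⟩ :=
    SimpleGraph.Walk.exists_isPath_forall_isPath_length_le_length (G.induce S)
  suffices h : ∀ w (hw : w ∈ S), G.Adj v w → ⟨w, hw⟩ = p.snd from
    ⟨v, v.2, fun a ha b hb => congrArg Subtype.val ((h a ha.2 ha.1).trans (h b hb.2 hb.1).symm)⟩
  intro w hw hvw
  have hadj : (G.induce S).Adj v ⟨w, hw⟩ := hvw
  refine (hG.induce S).eq_snd_of_adj_start hp hadj (by_contra fun hwp => ?_)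
  have hlt := hmax _ _ _ (hp.cons (h := hadj.symm) hwp)
  rw [SimpleGraph.Walk.length_cons] at hlt
  omega

namespace Multiquiver

section Incidence

variable {V E : Type*} {Γ : Multiquiver V E}

theorem Joins.symm {e : E} {a b : V} (h : Γ.Joins e a b) : Γ.Joins e b a := Or.symm h

theorem Joins.ne {e : E} {a b : V} (h : Γ.Joins e a b) : a ≠ b := by
  rcases h with ⟨m, n, hs, ht⟩ | ⟨m, n, hs, ht⟩
  · exact Γ.no_loops e a b m n hs ht
  · exact (Γ.no_loops e b a m n hs ht).symm

theorem Joins.sym2_eq {e : E} {a b c d : V} (h : Γ.Joins e a b) (h' : Γ.Joins e c d) :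
    s(a, b) = s(c, d) := by
  rcases h with ⟨m, n, hs, ht⟩ | ⟨m, n, hs, ht⟩ <;>
    rcases h' with ⟨m', n', hs', ht'⟩ | ⟨m', n', hs', ht'⟩ <;>
    simp_all

theorem mem_incident_of_entry_ne_zero {e : E} {v : V} (h : Γ.entry e v ≠ 0) :
    e ∈ Γ.incident v := by
  by_cases hs : mult (Γ.s e) v = 0
  · refine .inr (mult_ne_zero.1 fun ht => h ?_)
    rw [entry, hs, ht, sub_self]
  · exact .inl (mult_ne_zero.1 hs)

theorem joins_of_entry_ne_zero {e : E} {a b : V} (hab : a ≠ b) (ha : Γ.entry e a ≠ 0)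
    (hb : Γ.entry e b ≠ 0) : Γ.Joins e a b := by
  rcases mem_incident_of_entry_ne_zero ha with ⟨m, hm⟩ | ⟨m, hm⟩ <;>
    rcases mem_incident_of_entry_ne_zero hb with ⟨n, hn⟩ | ⟨n, hn⟩
  · simp_all
  · exact .inl ⟨m, n, hm, hn⟩
  · exact .inr ⟨n, m, hn, hm⟩
  · simp_all

variable (Γ) in
theorem γ_apply (h : V →₀ ℤ) (e : E) : Γ.γ h e = h.sum fun v p => p * Γ.entry e v := by
  rw [γ, Finsupp.linearCombination_apply, Finsupp.sum_apply]
  rfl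

variable (Γ) in
theorem γ_single_apply (v : V) (p : ℤ) (e : E) :
    Γ.γ (Finsupp.single v p) e = p * Γ.entry e v := by
  rw [γ_apply, Finsupp.sum_single_index (zero_mul _)]

theorem exists_entry_ne_zero_of_γ_apply_ne_zero {h : V →₀ ℤ} {e : E} (he : Γ.γ h e ≠ 0) :
    ∃ v ∈ h.support, Γ.entry e v ≠ 0 := by
  rw [γ_apply] at he
  obtain ⟨v, hv, hne⟩ := Finset.exists_ne_zero_of_sum_ne_zero he
  exact ⟨v, hv, right_ne_zero_of_mul hne⟩

theorem γ_apply_of_s_eq_of_t_eq {e : E} {a b : V} {m n : ℕ+} (hs : Γ.s e = some (a, m))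
    (ht : Γ.t e = some (b, n)) (h : V →₀ ℤ) : Γ.γ h e = n * h b - m * h a := by
  induction h using Finsupp.induction_linear with
  | zero => simp
  | add h h' ih ih' =>
    rw [map_add, Finsupp.add_apply, ih, ih', Finsupp.add_apply, Finsupp.add_apply]
    ring
  | single v p =>
    classical
    rw [γ_single_apply, entry, hs, ht]
    simp only [mult, Finsupp.single_apply, eq_comm (a := v), Nat.cast_ite, Nat.cast_zero]
    split_ifs <;> ring

end Incidence

section UnderlyingGraph

variable {V E : Type*} {Γ : Multiquiver V E}

variable (Γ) in
/-- The simple graph on the vertices of `Γ` obtained by forgetting half-edges, directions and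
multiplicities and identifying parallel edges. -/
def underlyingGraph : SimpleGraph V where
  Adj a b := ∃ e, Γ.Joins e a b
  symm := ⟨fun _ _ ⟨e, he⟩ => ⟨e, he.symm⟩⟩
  loopless := ⟨fun _ ⟨_, he⟩ => he.ne rfl⟩

theorem IsAcyclic.edge_unique (hΓ : Γ.IsAcyclic) {e f : E} {a b : V} (he : Γ.Joins e a b)
    (hf : Γ.Joins f a b) : e = f := by
  by_contra hne
  refine hΓ ⟨1, ![a, b], ![e, f], ?_, ?_, ?_⟩
  · simpa [Function.Injective, Fin.forall_fin_two, eq_comm] using he.ne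
  · simpa [Function.Injective, Fin.forall_fin_two, eq_comm] using hne
  · simpa [Fin.forall_fin_two] using ⟨he, hf.symm⟩

theorem IsAcyclic.isAcyclic_underlyingGraph (hΓ : Γ.IsAcyclic) : Γ.underlyingGraph.IsAcyclic := by
  refine SimpleGraph.isAcyclic_iff_free_cycleGraph.2 fun n hn ⟨v⟩ => ?_
  obtain ⟨n, rfl⟩ := Nat.exists_eq_add_of_le' hn
  have hadj (i : Fin (n + 3)) : ∃ e, Γ.Joins e (v i) (v (i + 1)) :=
    v.toHom.map_adj (by simp [SimpleGraph.cycleGraph_adj])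
  choose e he using hadj
  refine hΓ ⟨n + 2, v, e, v.injective, fun i j hij => ?_, he⟩
  rcases Sym2.eq_iff.1 ((he i).sym2_eq (hij ▸ he j)) with ⟨h, -⟩ | ⟨h, h'⟩
  · exact v.injective h
  · have hi : i = i + (1 + 1) := by
      rw [← add_assoc, v.injective h']
      exact v.injective h
    have htwo : (1 + 1 : Fin (n + 3)) = 0 := left_eq_add.1 hi
    simp [Fin.ext_iff, Fin.val_add, Nat.mod_eq_of_lt (by omega : 2 < n + 3)] at htwo

theorem IsAcyclic.exists_leaf (hΓ : Γ.IsAcyclic) {S : Set V} (hfin : S.Finite)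
    (hne : S.Nonempty) : ∃ v ∈ S, {e | ∃ b ∈ S, Γ.Joins e v b}.Subsingleton := by
  obtain ⟨v, hv, hleaf⟩ :=
    exists_neighborSet_inter_subsingleton hΓ.isAcyclic_underlyingGraph hfin hne
  refine ⟨v, hv, fun e ⟨a, ha, hea⟩ f ⟨b, hb, hfb⟩ => ?_⟩
  obtain rfl : a = b := hleaf ⟨⟨e, hea⟩, ha⟩ ⟨⟨f, hfb⟩, hb⟩
  exact hΓ.edge_unique hea hfb

end UnderlyingGraph

end Multiquiver

/-! ### The coefficient ideals of the image -/

namespace TGWDatum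

theorem eq_of_genDeg_pos {R I : Type*} {w : TGWGen R I} {a b : I} (ha : 0 < genDeg w a)
    (hb : 0 < genDeg w b) : a = b := by
  classical
  cases w <;> simp only [genDeg, Finsupp.single_apply, Finsupp.neg_apply, Finsupp.coe_zero,
    Pi.zero_apply] at ha hb <;> grind

end TGWDatum

namespace Multiquiver

section CoeffIdeal

variable {V E : Type*} (Γ : Multiquiver V E) (K : Type*) [Field K]

theorem map_φ_algPart (g : V →₀ ℤ) : (Γ.algPart K g).map (Γ.φ K).toLinearMap =
    ((Γ.datum K).constructionPart (μ V K) g).map (Γ.φConstruction K).toLinearMap := by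
  rw [algPart, TGWDatum.algPart, ← Submodule.map_comp]
  rfl

/-- The polynomial `q` such that a generator of degree `d` is mapped to `q(u) z^{γ(d)}`. -/
def genCoeff : TGWGen (MvPolynomial E K) V → MvPolynomial E K
  | .coeff r => r
  | .X _ => 1
  | .Y _ => 1

theorem φConstruction_gen_eq (w : TGWGen (MvPolynomial E K) V) :
    Γ.φConstruction K ((Γ.datum K).gen (μ V K) w) =
      Weyl.coeff K (genCoeff K w) * Weyl.z K (Γ.γ (TGWDatum.genDeg w)) := by
  rw [φConstruction_gen]
  cases w <;> simp [φGen, genCoeff, TGWDatum.genDeg, γ_single, Weyl.z_zero]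

theorem gen_mem_constructionPart (w : TGWGen (MvPolynomial E K) V) :
    (Γ.datum K).gen (μ V K) w ∈
      (Γ.datum K).constructionPart (μ V K) (TGWDatum.genDeg w) :=
  Submodule.subset_span ⟨[w], by simp, by simp⟩

/-- The ideal of all `q` with `q(u) z^{γ(g)} ∈ φ_Γ(A(Γ)_g)`. -/
def coeffIdeal (g : V →₀ ℤ) : Ideal (MvPolynomial E K) where
  carrier := {q | ∃ a ∈ (Γ.datum K).constructionPart (μ V K) g,
    Γ.φConstruction K a = Weyl.coeff K q * Weyl.z K (Γ.γ g)}
  zero_mem' := ⟨0, zero_mem _, by simp⟩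
  add_mem' := by
    rintro p q ⟨a, ha, hap⟩ ⟨b, hb, hbq⟩
    exact ⟨a + b, add_mem ha hb, by rw [map_add, hap, hbq, map_add, add_mul]⟩
  smul_mem' := by
    rintro r q ⟨a, ha, haq⟩
    refine ⟨(Γ.datum K).gen (μ V K) (.coeff r) * a, ?_, ?_⟩
    · have h := mul_mem_gradedPart _ _ (Γ.gen_mem_constructionPart K (.coeff r)) ha
      rwa [TGWDatum.genDeg, zero_add] at h
    · rw [map_mul, haq, φConstruction_gen, φGen, smul_eq_mul, map_mul, mul_assoc]

theorem isLocallySurjective_iff_forall_coeffIdeal_eq_top :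
    Γ.IsLocallySurjective K ↔ ∀ g, Γ.coeffIdeal K g = ⊤ := by
  refine forall_congr' fun g => ?_
  rw [map_φ_algPart, Ideal.eq_top_iff_one]
  constructor
  · intro h
    obtain ⟨a, ha, haz⟩ := h.ge (Weyl.z_mem_part K (Γ.γ g))
    exact ⟨a, ha, by rw [map_one, one_mul]; exact haz⟩
  · intro h
    refine le_antisymm (Submodule.map_le_iff_le_comap.2 fun a => Γ.φConstruction_mem_part K) ?_
    intro a ha
    obtain ⟨q, rfl⟩ := Weyl.exists_eq_of_mem_part K ha
    exact mul_one q ▸ (Γ.coeffIdeal K g).mul_mem_left q h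

variable {Γ K}

theorem mul_mem_coeffIdeal_add {g h : V →₀ ℤ} {p q : MvPolynomial E K}
    (hp : p ∈ Γ.coeffIdeal K g) (hq : q ∈ Γ.coeffIdeal K h) :
    p * (Weyl.shift K (Γ.γ g) q * Weyl.cocycle K (Γ.γ g) (Γ.γ h)) ∈ Γ.coeffIdeal K (g + h) := by
  obtain ⟨a, ha, hap⟩ := hp
  obtain ⟨b, hb, hbq⟩ := hq
  refine ⟨a * b, mul_mem_gradedPart _ _ ha hb, ?_⟩
  rw [map_mul, hap, hbq, Weyl.coeff_mul_z_mul_coeff_mul_z, map_add]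

theorem cocycle_mem_coeffIdeal_add {g h : V →₀ ℤ} (hg : Γ.coeffIdeal K g = ⊤)
    (hh : Γ.coeffIdeal K h = ⊤) :
    Weyl.cocycle K (Γ.γ g) (Γ.γ h) ∈ Γ.coeffIdeal K (g + h) := by
  simpa only [map_one, one_mul] using mul_mem_coeffIdeal_add
    ((Ideal.eq_top_iff_one _).1 hg) ((Ideal.eq_top_iff_one _).1 hh)

theorem coeffIdeal_add_eq_top {g h : V →₀ ℤ} (hg : Γ.coeffIdeal K g = ⊤)
    (hh : Γ.coeffIdeal K h = ⊤)
    (hgh : IsCoprime (Weyl.cocycle K (Γ.γ g) (Γ.γ h)) (Weyl.cocycle K (Γ.γ h) (Γ.γ g))) :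
    Γ.coeffIdeal K (g + h) = ⊤ := by
  obtain ⟨a, b, hab⟩ := hgh
  rw [Ideal.eq_top_iff_one, ← hab]
  exact add_mem (Ideal.mul_mem_left _ a (cocycle_mem_coeffIdeal_add hg hh))
    (Ideal.mul_mem_left _ b (add_comm h g ▸ cocycle_mem_coeffIdeal_add hh hg))

variable (Γ K)

theorem genCoeff_mem_coeffIdeal (w : TGWGen (MvPolynomial E K) V) :
    genCoeff K w ∈ Γ.coeffIdeal K (TGWDatum.genDeg w) :=
  ⟨_, Γ.gen_mem_constructionPart K w, Γ.φConstruction_gen_eq K w⟩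

theorem coeffIdeal_zero_eq_top : Γ.coeffIdeal K 0 = ⊤ :=
  (Ideal.eq_top_iff_one _).2 (Γ.genCoeff_mem_coeffIdeal K (.coeff 1))

theorem coeffIdeal_single_eq_top (v : V) (p : ℤ) : Γ.coeffIdeal K (Finsupp.single v p) = ⊤ := by
  have hone (m n : ℤ) (hmn : 0 ≤ m * n) :
      Weyl.cocycle K (Γ.γ (Finsupp.single v m)) (Γ.γ (Finsupp.single v n)) = 1 :=
    Weyl.cocycle_of_mul_nonneg K fun e => by
      rw [γ_single_apply, γ_single_apply, mul_mul_mul_comm]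
      exact mul_nonneg hmn (mul_self_nonneg _)
  induction p using Int.induction_on with
  | zero => rw [Finsupp.single_zero, coeffIdeal_zero_eq_top]
  | succ n ih =>
    rw [Finsupp.single_add]
    refine coeffIdeal_add_eq_top ih ((Ideal.eq_top_iff_one _).2
      (Γ.genCoeff_mem_coeffIdeal K (.X v))) ?_
    rw [hone n 1 (by simp)]
    exact isCoprime_one_left
  | pred n ih =>
    rw [sub_eq_add_neg, Finsupp.single_add]
    refine coeffIdeal_add_eq_top ih ?_ ?_
    · rw [Finsupp.single_neg]
      exact (Ideal.eq_top_iff_one _).2 (Γ.genCoeff_mem_coeffIdeal K (.Y v))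
    · rw [hone (-n) (-1) (by simp)]
      exact isCoprime_one_left

variable {Γ} in
theorem IsAcyclic.coeffIdeal_eq_top [CharZero K] (hΓ : Γ.IsAcyclic) (g : V →₀ ℤ) :
    Γ.coeffIdeal K g = ⊤ := by
  classical
  induction hS : g.support using Finset.strongInduction generalizing g with
  | H S ih =>
    subst hS
    rcases g.support.eq_empty_or_nonempty with hg | hg
    · rw [Finsupp.support_eq_empty.1 hg, coeffIdeal_zero_eq_top]
    obtain ⟨v, hv, hleaf⟩ := hΓ.exists_leaf g.support.finite_toSet hg
    have herase : Γ.coeffIdeal K (g.erase v) = ⊤ :=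
      ih _ (by rw [Finsupp.support_erase]; exact Finset.erase_ssubset hv) _ rfl
    suffices h : Γ.coeffIdeal K (.single v (g v) + g.erase v) = ⊤ by
      rwa [Finsupp.single_add_erase] at h
    refine coeffIdeal_add_eq_top (Γ.coeffIdeal_single_eq_top K v (g v)) herase
      (Weyl.isCoprime_cocycle K (hleaf.anti ?_))
    rintro e ⟨hev, he⟩
    rw [γ_single_apply] at hev
    obtain ⟨b, hb, heb⟩ := exists_entry_ne_zero_of_γ_apply_ne_zero he
    rw [Finsupp.support_erase, Finset.mem_erase] at hb
    exact ⟨b, hb.2, joins_of_entry_ne_zero hb.1.symm (right_ne_zero_of_mul hev) heb⟩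

end CoeffIdeal

end Multiquiver

/-! ### Words along a cycle -/

namespace Multiquiver

section Cycle

variable {V E : Type*} (Γ : Multiquiver V E) (K : Type*) [Field K]

/-- The polynomial `q` such that a word of degree `g` in the generators is mapped to
`q(u) z^{γ(g)}`. -/
def wordCoeff : List (TGWGen (MvPolynomial E K) V) → MvPolynomial E K
  | [] => 1
  | w :: l => genCoeff K w * (Weyl.shift K (Γ.γ (TGWDatum.genDeg w)) (wordCoeff l) *
      Weyl.cocycle K (Γ.γ (TGWDatum.genDeg w)) (Γ.γ (l.map TGWDatum.genDeg).sum))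

theorem φConstruction_prod_map_gen (l : List (TGWGen (MvPolynomial E K) V)) :
    Γ.φConstruction K (l.map ((Γ.datum K).gen (μ V K))).prod =
      Weyl.coeff K (Γ.wordCoeff K l) * Weyl.z K (Γ.γ (l.map TGWDatum.genDeg).sum) := by
  induction l with
  | nil => simp [wordCoeff, Weyl.z_zero]
  | cons w l ih =>
    rw [List.map_cons, List.prod_cons, map_mul, φConstruction_gen_eq, ih,
      Weyl.coeff_mul_z_mul_coeff_mul_z, List.map_cons, List.sum_cons, map_add, wordCoeff]

variable {Γ K}

theorem coeffIdeal_le_of_forall_wordCoeff_mem {g : V →₀ ℤ} {J : Ideal (MvPolynomial E K)}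
    (hJ : ∀ l : List (TGWGen (MvPolynomial E K) V),
      (l.map TGWDatum.genDeg).sum = g → Γ.wordCoeff K l ∈ J) :
    Γ.coeffIdeal K g ≤ J := by
  let mulZ := LinearMap.mulRight K (Weyl.z K (Γ.γ g)) ∘ₗ (Weyl.coeff K).toLinearMap
  have himage : ((Γ.datum K).constructionPart (μ V K) g).map (Γ.φConstruction K).toLinearMap ≤
      (J.restrictScalars K).map mulZ := by
    refine Submodule.map_le_iff_le_comap.2 (Submodule.span_le.2 ?_)
    rintro _ ⟨l, rfl, rfl⟩
    exact ⟨Γ.wordCoeff K l, hJ l rfl, (Γ.φConstruction_prod_map_gen K l).symm⟩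
  rintro q ⟨a, ha, haq⟩
  obtain ⟨p, hp, hpa⟩ := himage ⟨a, ha, rfl⟩
  exact Weyl.coeff_mul_z_injective K (Γ.γ g) (hpa.trans haq) ▸ hp

variable (Γ) in
/-- Translating by `γ(h)` moves the point `c` of the `e`-axis to a point on the same side of the
wall between `0` and `1`. -/
def KeepsSide (c : ℤ) (h : V →₀ ℤ) (e : E) : Prop := 0 < c + Γ.γ h e ↔ 0 < c

variable (Γ K) in
/-- A set `T` of degrees that a word, read from right to left, can only enter by a letter that
brings one of the coordinates `c e + γ(h)_e` of its current degree `h` back to the side of the wall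
on which it started. -/
structure IsBarrier (T : Set (V →₀ ℤ)) (c : E → ℤ) : Prop where
  zero_notMem : 0 ∉ T
  exists_return : ∀ (w : TGWGen (MvPolynomial E K) V) (h : V →₀ ℤ), h ∉ T →
    TGWDatum.genDeg w + h ∈ T →
    ∃ e, ¬ Γ.KeepsSide (c e) h e ∧ Γ.KeepsSide (c e) (TGWDatum.genDeg w + h) e

theorem IsBarrier.eval_wordCoeff_eq_zero {T : Set (V →₀ ℤ)} {c : E → ℤ} (hT : Γ.IsBarrier K T c)
    {l : List (TGWGen (MvPolynomial E K) V)} (hl : (l.map TGWDatum.genDeg).sum ∈ T) :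
    MvPolynomial.eval (fun e => ((c e + Γ.γ (l.map TGWDatum.genDeg).sum e : ℤ) : K))
      (Γ.wordCoeff K l) = 0 := by
  induction l with
  | nil => exact absurd hl hT.zero_notMem
  | cons w l ih =>
    rw [List.map_cons, List.sum_cons] at hl ⊢
    rw [wordCoeff, map_mul, map_mul]
    by_cases hmem : (l.map TGWDatum.genDeg).sum ∈ T
    · rw [Weyl.eval_shift]
      simp only [map_add, Finsupp.add_apply, add_sub_assoc, add_sub_cancel, ih hmem, zero_mul,
        mul_zero]
    · obtain ⟨e, hcross, hreturn⟩ := hT.exists_return w _ hmem hl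
      rw [Weyl.eval_cocycle_eq_zero K (e := e), mul_zero, mul_zero]
      rw [KeepsSide, map_add, Finsupp.add_apply] at hreturn
      rw [KeepsSide] at hcross
      rw [Weyl.mem_crossings, map_add, Finsupp.add_apply]
      grind

theorem IsBarrier.coeffIdeal_ne_top {T : Set (V →₀ ℤ)} {c : E → ℤ} (hT : Γ.IsBarrier K T c)
    {g : V →₀ ℤ} (hg : g ∈ T) : Γ.coeffIdeal K g ≠ ⊤ := by
  let evalEnd := MvPolynomial.eval fun e => ((c e + Γ.γ g e : ℤ) : K)
  refine ne_top_of_le_ne_top (RingHom.ker_ne_top evalEnd)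
    (coeffIdeal_le_of_forall_wordCoeff_mem ?_)
  rintro l rfl
  exact hT.eval_wordCoeff_eq_zero hg

theorem Joins.exists_forall_keepsSide_imp {e : E} {a b : V} (he : Γ.Joins e a b) :
    ∃ c : ℤ, (∀ h, Γ.KeepsSide c h e → 0 < h b → 0 < h a) ∧
      ∀ h : V →₀ ℤ, h a = 1 → h b = 1 → Γ.KeepsSide c h e := by
  rcases he with ⟨m, n, hs, ht⟩ | ⟨m, n, hs, ht⟩
  · have hm : (0 : ℤ) < m := mod_cast m.pos
    have hn : (0 : ℤ) < n := mod_cast n.pos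
    refine ⟨1 - n, fun h hk hb => ?_, fun h ha hb => ?_⟩
    · rw [KeepsSide, γ_apply_of_s_eq_of_t_eq hs ht] at hk
      by_contra! ha
      have hmove : (0 : ℤ) < 1 - n + (n * h b - m * h a) := by nlinarith
      have := hk.1 hmove
      omega
    · rw [KeepsSide, γ_apply_of_s_eq_of_t_eq hs ht, ha, hb]
      omega
  · have hm : (0 : ℤ) < m := mod_cast m.pos
    have hn : (0 : ℤ) < n := mod_cast n.pos
    refine ⟨m, fun h hk hb => ?_, fun h ha hb => ?_⟩
    · rw [KeepsSide, γ_apply_of_s_eq_of_t_eq hs ht] at hk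
      have hmove := hk.2 hm
      by_contra! ha
      nlinarith
    · rw [KeepsSide, γ_apply_of_s_eq_of_t_eq hs ht, ha, hb]
      omega

theorem isBarrier_of_cycle {n : ℕ} {v : Fin (n + 1) → V} {e : Fin (n + 1) → E}
    (hjoin : ∀ i, Γ.Joins (e i) (v i) (v (i + 1))) {c : E → ℤ}
    (hback : ∀ i h, Γ.KeepsSide (c (e i)) h (e i) → 0 < h (v (i + 1)) → 0 < h (v i)) :
    Γ.IsBarrier K {h | (∀ i, Γ.KeepsSide (c (e i)) h (e i)) ∧ ∃ i, 0 < h (v i)} c where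
  zero_notMem := fun ⟨_, _, hi⟩ => lt_irrefl _ hi
  exists_return := by
    rintro w h hh ⟨hkeep, i, hi⟩
    suffices hcross : ∃ j, ¬ Γ.KeepsSide (c (e j)) h (e j) from
      hcross.elim fun j hj => ⟨e j, hj, hkeep j⟩
    by_contra! hkeep'
    have hnonpos (j : Fin (n + 1)) : h (v j) ≤ 0 := not_lt.1 fun hj => hh ⟨hkeep', j, hj⟩
    have hw (j : Fin (n + 1)) (hj : 0 < (TGWDatum.genDeg w + h) (v j)) :
        0 < TGWDatum.genDeg w (v j) :=
      hj.trans_le (add_le_of_nonpos_right (hnonpos j))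
    -- A single letter cannot make `h` positive at both `v j` and `v (j + 1)`.
    obtain ⟨j, rfl⟩ : ∃ j, j + 1 = i := ⟨i - 1, sub_add_cancel i 1⟩
    exact (hjoin j).ne (TGWDatum.eq_of_genDeg_pos (hw j (hback j _ (hkeep j) hi)) (hw _ hi))

theorem coeffIdeal_sum_single_ne_top {n : ℕ} {v : Fin (n + 1) → V} {e : Fin (n + 1) → E}
    (hv : Function.Injective v) (he : Function.Injective e)
    (hjoin : ∀ i, Γ.Joins (e i) (v i) (v (i + 1))) :
    Γ.coeffIdeal K (∑ i, Finsupp.single (v i) 1) ≠ ⊤ := by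
  classical
  obtain ⟨c, hc⟩ : ∃ c : E → ℤ, ∀ i,
      (∀ h, Γ.KeepsSide (c (e i)) h (e i) → 0 < h (v (i + 1)) → 0 < h (v i)) ∧
      ∀ h : V →₀ ℤ, h (v i) = 1 → h (v (i + 1)) = 1 → Γ.KeepsSide (c (e i)) h (e i) := by
    choose c hc using fun i => (hjoin i).exists_forall_keepsSide_imp
    exact ⟨Function.extend e c 0, fun i => by simpa only [he.extend_apply] using hc i⟩
  have hsum (i : Fin (n + 1)) : (∑ j, Finsupp.single (v j) (1 : ℤ)) (v i) = 1 := by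
    simp [Finsupp.finsetSum_apply, Finsupp.single_apply, hv.eq_iff]
  exact (isBarrier_of_cycle hjoin fun i => (hc i).1).coeffIdeal_ne_top
    ⟨fun i => (hc i).2 _ (hsum i) (hsum _), 0, (hsum 0).symm ▸ one_pos⟩

theorem IsLocallySurjective.isAcyclic (hφ : Γ.IsLocallySurjective K) : Γ.IsAcyclic := by
  rintro ⟨n, v, e, hv, he, hjoin⟩
  exact coeffIdeal_sum_single_ne_top hv he hjoin
    ((Γ.isLocallySurjective_iff_forall_coeffIdeal_eq_top K).1 hφ _)

end Cycle

end Multiquiver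

end MultiquiverTGW

end

theorem theorem4p10 {K V E : Type*} [Field K] [CharZero K] (Γ : MultiquiverTGW.Multiquiver V E) :
    Γ.IsLocallySurjective K ↔ Γ.IsAcyclic :=
  ⟨fun hφ => hφ.isAcyclic, fun hΓ =>
    (Γ.isLocallySurjective_iff_forall_coeffIdeal_eq_top K).2 (hΓ.coeffIdeal_eq_top K)⟩
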